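/- Let $X$ be a complex Banach space and let $-A$ be the generator of a bounded $C_0$-semigroup $(T(t))_{t\ge 0}$ on $X$. Write $\mathbb{C}_+=\{z\in\mathbb{C}:\operatorname{Re} z>0\}$ and let $\mathcal{E}$ be the algebra of functions on $\mathbb{C}_+$ of the form $h(z)=\int_{[0,\infty)}e^{-zt}\,\mu(dt)$, where $\mu$ is a complex Borel measure on $[0,\infty)$ (hence of finite total variation). For such $h$ put $h(A)x=\int_{[0,\infty)}T(t)x\,\mu(dt)$ for $x\in X$ (the Hille–Phillips calculus); this is a bounded operator on $X$. A function $e\in\mathcal{E}$ is a regulariser for a holomorphic function $h:\mathbb{C}_+\to\mathbb{C}$ if $eh\in\mathcal{E}$ and $e(A)$ is injective. If $h$ has a regulariser, then $h$ is called regularisable and $h(A):=e(A)^{-1}(eh)(A)$, with domain $\{x\in X:(eh)(A)x\in\operatorname{ran}e(A)\}$; this does not depend on the choice of $e$ (the extended Hille–Phillips calculus). A Bernstein function is a function $f\in C^\infty(0,\infty)$ with $f\ge 0$ such that $(-1)^m (f')^{(m)}\ge 0$ on $(0,\infty)$ for all integers $m\ge 0$. A special Bernstein function is a non-zero Bernstein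 function $f$ such that $z\mapsto z/f(z)$ is also a Bernstein function. Let $f_1,\dots,f_n$ be special Bernstein functions, and let $g:\mathbb{C}_+\to\mathbb{C}$ be a holomorphic function which, for some $k\in\mathbb{N}$, has the regulariser $\psi_k(z)=(1+z)^{-k}$. Then each $f_i$ extends (uniquely) to a holomorphic function on $\mathbb{C}_+$, again denoted by $f_i$; the functions $f_1,\dots,f_n$ and $f_1\cdots f_n\,g$ are regularisable; and $$f_1(A)f_2(A)\cdots f_n(A)\,g(A)=[f_1f_2\cdots f_n\,g](A),$$ an equality of unbounded operators including their domains, where a product $RS$ of unbounded operators has domain $\{x\in\operatorname{dom}S: Sx\in\operatorname{dom}R\}$. -/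

import Mathlib

open Set Filter Topology MeasureTheory
open scoped NNReal ENNReal ContDiff

noncomputable section

namespace HillePhillips

/-! ### Bernstein functions -/

/-- `φ` is completely monotone on `(0, ∞)`: it is smooth there and `(-1)^n φ^(n) ≥ 0` for all `n`.
Only the values of `φ` on `(0, ∞)` matter. -/
def IsCompletelyMonotone (φ : ℝ → ℝ) : Prop :=
  ContDiffOn ℝ ∞ φ (Ioi 0) ∧ ∀ n : ℕ, ∀ t : ℝ, 0 < t → 0 ≤ (-1) ^ n * iteratedDeriv n φ t

/-- `φ` is a Bernstein function on `(0, ∞)`. -/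
def IsBernstein (φ : ℝ → ℝ) : Prop :=
  ContDiffOn ℝ ∞ φ (Ioi 0) ∧ (∀ t : ℝ, 0 < t → 0 ≤ φ t) ∧ IsCompletelyMonotone (deriv φ)

/-- `φ` is a special Bernstein function: a non-zero Bernstein function such that `t / φ t` is a
Bernstein function. (A non-zero Bernstein function has no zeros on `(0, ∞)`.) -/
def IsSpecialBernstein (φ : ℝ → ℝ) : Prop :=
  IsBernstein φ ∧ (∃ t : ℝ, 0 < t ∧ φ t ≠ 0) ∧ IsBernstein (fun t => t / φ t)

/-- The open right half-plane. -/
def rightHalfPlane : Set ℂ := {z | 0 < z.re}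

/-- `F` is holomorphic on the right half-plane and extends `φ` (from `(0, ∞)`). -/
def IsHolExt (φ : ℝ → ℝ) (F : ℂ → ℂ) : Prop :=
  DifferentiableOn ℂ F rightHalfPlane ∧ ∀ t : ℝ, 0 < t → F (t : ℂ) = (φ t : ℂ)

open Classical in
/-- The holomorphic extension of `φ` to the right half-plane, when there is one (it is then unique
on the half-plane, and its values elsewhere are irrelevant); `0` otherwise. -/
def holExt (φ : ℝ → ℝ) : ℂ → ℂ :=
  if h : ∃ F, IsHolExt φ F then h.choose else 0

/-! ### Complex measures on `[0, ∞)` and their Laplace transforms -/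

/-- The integral of a vector-valued function against a complex measure on `[0, ∞)`. -/
def cintegral {X : Type*} [NormedAddCommGroup X] [NormedSpace ℂ X]
    (μ : ComplexMeasure ℝ≥0) (f : ℝ≥0 → X) : X :=
  μ.integral f (ContinuousLinearMap.lsmul ℝ ℂ : ℂ →L[ℝ] X →L[ℝ] X).flip

/-- On the right half-plane, `f` is the Laplace transform of the complex measure `μ` (which has
finite total variation, as every complex measure). -/
def IsLaplaceTransform (μ : ComplexMeasure ℝ≥0) (f : ℂ → ℂ) : Prop :=
  ∀ z ∈ rightHalfPlane, f z = cintegral μ (fun t : ℝ≥0 => Complex.exp (-(z * ((t : ℝ) : ℂ))))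

/-- The algebra of Laplace transforms of complex measures on `[0, ∞)`. -/
def InLaplaceAlgebra (f : ℂ → ℂ) : Prop :=
  ∃ μ : ComplexMeasure ℝ≥0, IsLaplaceTransform μ f

/-- Complex measures have finite variation. -/
theorem isFiniteMeasure_variation (μ : ComplexMeasure ℝ≥0) : IsFiniteMeasure μ.variation := by
  have h : μ.variation ≤ (ComplexMeasure.re μ).variation + (ComplexMeasure.im μ).variation := by
    apply VectorMeasure.variation_le_of_forall_enorm_le
    intro s _
    have h1 : ‖μ s‖ₑ ≤ ‖(μ s).re‖ₑ + ‖(μ s).im‖ₑ := by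
      rw [← ofReal_norm, ← ofReal_norm, ← ofReal_norm,
        ← ENNReal.ofReal_add (norm_nonneg _) (norm_nonneg _)]
      exact ENNReal.ofReal_le_ofReal (Complex.norm_le_abs_re_add_abs_im _)
    rw [Measure.add_apply]
    exact h1.trans (add_le_add ((ComplexMeasure.re μ).enorm_measure_le_variation s)
      ((ComplexMeasure.im μ).enorm_measure_le_variation s))
  rw [← SignedMeasure.totalVariation_eq_variation, ← SignedMeasure.totalVariation_eq_variation] at h
  exact isFiniteMeasure_of_le _ h

/-! ### Bounded `C₀`-semigroups and the Hille-Phillips calculus -/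

variable {X : Type*} [NormedAddCommGroup X] [NormedSpace ℂ X]

/-- A bounded strongly continuous one-parameter semigroup of operators on `X`. -/
structure BoundedC0Semigroup (X : Type*) [NormedAddCommGroup X] [NormedSpace ℂ X] where
  /-- The operators of the semigroup. -/
  op : ℝ≥0 → X →L[ℂ] X
  op_zero : op 0 = 1
  op_add : ∀ s t, op (s + t) = op s * op t
  continuous_op : ∀ x, Continuous fun t => op t x
  bounded : ∃ M : ℝ, ∀ t, ‖op t‖ ≤ M

/-- `B` is the generator of the semigroup `T`: `x ∈ dom B` and `B x = y` if and only if
`(T(t) x - x) / t → y` as `t → 0+`. -/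
def IsGenerator (T : BoundedC0Semigroup X) (B : X →ₗ.[ℂ] X) : Prop :=
  ∀ x y : X, (x, y) ∈ B.graph ↔
    Tendsto (fun t : ℝ≥0 => (((t : ℝ) : ℂ))⁻¹ • (T.op t x - x)) (𝓝[>] 0) (𝓝 y)

theorem integrable_orbit (T : BoundedC0Semigroup X) (μ : ComplexMeasure ℝ≥0) (x : X) :
    μ.Integrable (fun t => T.op t x) := by
  have := isFiniteMeasure_variation μ
  obtain ⟨M, hM⟩ := T.bounded
  refine Integrable.of_bound (T.continuous_op x).aestronglyMeasurable (M * ‖x‖)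
    (Eventually.of_forall fun t => ?_)
  exact (T.op t).le_of_opNorm_le (hM t) x

theorem cintegral_smul (μ : ComplexMeasure ℝ≥0) (c : ℂ) (f : ℝ≥0 → X) :
    cintegral μ (fun t => c • f t) = c • cintegral μ f := by
  unfold cintegral
  rw [VectorMeasure.integral_eq_setToFun, VectorMeasure.integral_eq_setToFun]
  refine setToFun_smul _ (fun c s x => ?_) c f
  change (μ s) • (c • x) = c • ((μ s) • x)
  exact smul_comm _ _ _

/-- The bounded operator `x ↦ ∫ T(t) x dμ(t)`. -/
def measureOp (T : BoundedC0Semigroup X) (μ : ComplexMeasure ℝ≥0) : X →L[ℂ] X :=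
  LinearMap.mkContinuousOfExistsBound
    { toFun := fun x => cintegral μ (fun t => T.op t x)
      map_add' := fun x y => by
        simp only [map_add]
        exact VectorMeasure.integral_fun_add (integrable_orbit T μ x) (integrable_orbit T μ y)
      map_smul' := fun c x => by
        simp only [map_smul, RingHom.id_apply]
        exact cintegral_smul μ c _ }
    (by
      have := isFiniteMeasure_variation μ
      obtain ⟨M, hM⟩ := T.bounded
      refine ⟨M * ‖(ContinuousLinearMap.lsmul ℝ ℂ : ℂ →L[ℝ] X →L[ℝ] X).flip‖ *
        μ.variation.real univ, fun x => ?_⟩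
      have h := VectorMeasure.norm_integral_le_of_norm_le_const (μ := μ)
        (B := (ContinuousLinearMap.lsmul ℝ ℂ : ℂ →L[ℝ] X →L[ℝ] X).flip)
        (f := fun t => T.op t x) (C := M * ‖x‖)
        (Eventually.of_forall fun t => (T.op t).le_of_opNorm_le (hM t) x)
      refine (le_of_eq rfl).trans (h.trans (le_of_eq ?_))
      ring)

@[simp]
theorem measureOp_apply (T : BoundedC0Semigroup X) (μ : ComplexMeasure ℝ≥0) (x : X) :
    measureOp T μ x = cintegral μ (fun t => T.op t x) := rfl

open Classical in
/-- The Hille-Phillips calculus: the operator `∫ T(t) dμ(t)` for `f` the Laplace transform of `μ`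
(which is uniquely determined by `f`); `0` if `f` is not such a Laplace transform. -/
def hpBounded (T : BoundedC0Semigroup X) (f : ℂ → ℂ) : X →L[ℂ] X :=
  if h : InLaplaceAlgebra f then measureOp T h.choose else 0

/-- `e` is a regulariser for the holomorphic function `f`. -/
def IsRegulariser (T : BoundedC0Semigroup X) (e f : ℂ → ℂ) : Prop :=
  DifferentiableOn ℂ f rightHalfPlane ∧ InLaplaceAlgebra e ∧ InLaplaceAlgebra (e * f) ∧
    Function.Injective (hpBounded T e)

/-- `f` is regularisable. -/
def IsRegularisable (T : BoundedC0Semigroup X) (f : ℂ → ℂ) : Prop :=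
  ∃ e, IsRegulariser T e f

/-- The operator `R⁻¹ S` with domain `{x | S x ∈ ran R}`, for bounded operators `R`, `S` with `R`
injective. Its graph is `{(x, y) | S x = R y}`. -/
def invMul (R S : X →L[ℂ] X) : X →ₗ.[ℂ] X :=
  (LinearMap.eqLocus (S.toLinearMap ∘ₗ LinearMap.fst ℂ X X)
    (R.toLinearMap ∘ₗ LinearMap.snd ℂ X X)).toLinearPMap

open Classical in
/-- The extended Hille-Phillips calculus, `f(A) = e(A)⁻¹ (e f)(A)` for any regulariser `e` of `f`
(the result does not depend on `e`), where `-A` is the generator of `T`; the junk value `0` if `f`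
is not regularisable. -/
def hpCalculus (T : BoundedC0Semigroup X) (f : ℂ → ℂ) : X →ₗ.[ℂ] X :=
  if h : IsRegularisable T f then invMul (hpBounded T h.choose) (hpBounded T (h.choose * f)) else 0

/-- The product `R S` of unbounded operators, on its natural domain
`{x ∈ dom S | S x ∈ dom R}`. -/
def opMul (R S : X →ₗ.[ℂ] X) : X →ₗ.[ℂ] X where
  domain :=
    { carrier := {x | ∃ hx : x ∈ S.domain, S ⟨x, hx⟩ ∈ R.domain}
      zero_mem' := ⟨S.domain.zero_mem, by
        have h : S ⟨0, S.domain.zero_mem⟩ = 0 := S.map_zero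
        rw [h]
        exact R.domain.zero_mem⟩
      add_mem' := by
        rintro x y ⟨hx, hx'⟩ ⟨hy, hy'⟩
        refine ⟨S.domain.add_mem hx hy, ?_⟩
        have h := S.map_add ⟨x, hx⟩ ⟨y, hy⟩
        have h2 := R.domain.add_mem hx' hy'
        rw [← h] at h2
        exact h2
      smul_mem' := by
        rintro c x ⟨hx, hx'⟩
        refine ⟨S.domain.smul_mem c hx, ?_⟩
        have h := S.map_smul c ⟨x, hx⟩
        have h2 := R.domain.smul_mem c hx'
        rw [← h] at h2
        exact h2 }
  toFun :=
    { toFun := fun x => R ⟨S ⟨x.1, x.2.1⟩, x.2.2⟩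
      map_add' := fun x y => by
        rw [← R.map_add]
        congr 1
        exact Subtype.ext (S.map_add ⟨x.1, x.2.1⟩ ⟨y.1, y.2.1⟩)
      map_smul' := fun c x => by
        rw [RingHom.id_apply, ← R.map_smul]
        congr 1
        exact Subtype.ext (S.map_smul c ⟨x.1, x.2.1⟩) }

/-- The function `ψ_k(z) = 1 / (1 + z)^k`. -/
def psi (k : ℕ) : ℂ → ℂ := fun z => 1 / (1 + z) ^ k

end HillePhillips

end

noncomputable section

namespace HillePhillips

/-! ### Taylor expansion of completely monotone functions -/

/-! Write E for the algebra of Laplace transforms. Let `f` be special Bernstein and let `g` be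
regularised by `psi k`. That f(A)g(A) is contained in (fg)(A) is formal; the content is that every x
in dom (fg)(A), with value y say, already lies in dom g(A). Specialness provides a second Bernstein
function h(z) = z/f(z), so z = fh, and a geometric sum gives 1 = ψ_k + z ψ_1 Σ_{j<k} ψ_j. Hence 1 =
ψ_k + fG with G = ψ_1 h Σ_{j<k} ψ_j in E. Multiplying by ψ_k g and evaluating at x gives (ψ_k g)(A)x
= ψ_k(A)((ψ_k g)(A)x + G(A)y), which exhibits g(A)x. This is `IsSpecialBernstein.opMul_hpCalculus`;
the case of n factors follows by induction.

The argument needs ψ_1 f in E for every Bernstein f (`IsBernstein.exists_isHolExt`). It follows from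
f(z) = a + z p̂(z) - q̂(z) with finite measures p, q, which in turn rests on Bernstein's theorem for
bounded completely monotone functions. That theorem is proved by turning Taylor coefficients at R
into measures on [0,1] and letting R tend to infinity along an ultrafilter.

It also needs the calculus to be well defined and multiplicative. Uniqueness of the representing
measure comes from characteristic functions. `transform` carries the Laplace transform and the
operator of a measure together, so one convolution formula for finite measures handles products of
both. Finally ψ_k(A) is injective because (1+sA)⁻¹ converges strongly to the identity as s → 0+. -/

theorem contDiffAt_of_contDiffOn_Ioi {φ : ℝ → ℝ} (h : ContDiffOn ℝ ∞ φ (Ioi 0)) {t : ℝ}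
    (ht : 0 < t) (n : ℕ) : ContDiffAt ℝ n φ t :=
  (h.contDiffAt (Ioi_mem_nhds ht)).of_le (mod_cast le_top)

theorem differentiableAt_iteratedDeriv {φ : ℝ → ℝ} (h : ContDiffOn ℝ ∞ φ (Ioi 0)) {t : ℝ}
    (ht : 0 < t) (n : ℕ) : DifferentiableAt ℝ (iteratedDeriv n φ) t := by
  have h1 : DifferentiableOn ℝ (iteratedDerivWithin n φ (Ioi 0)) (Ioi 0) :=
    h.differentiableOn_iteratedDerivWithin (mod_cast WithTop.coe_lt_top _) (uniqueDiffOn_Ioi 0)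
  have h2 := (h1 t ht).differentiableAt (Ioi_mem_nhds ht)
  refine h2.congr_of_eventuallyEq ?_
  filter_upwards [Ioi_mem_nhds ht] with s hs
  exact (iteratedDerivWithin_of_isOpen isOpen_Ioi hs).symm

/-- Taylor's formula at R, evaluated to the left of R: moving the sign of (x - R)^k onto the
derivative makes every term, and the remainder, nonnegative for completely monotone functions. -/
theorem taylor_remainder_alternating {φ : ℝ → ℝ} (h : ContDiffOn ℝ ∞ φ (Ioi 0)) {x R : ℝ}
    (hx : 0 < x) (hxR : x < R) (n : ℕ) :
    φ x - ∑ k ∈ Finset.range (n + 1),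
      (R - x) ^ k / (k.factorial : ℝ) * ((-1) ^ k * iteratedDeriv k φ R) =
    ∫ t in x..R, (t - x) ^ n / (n.factorial : ℝ) * ((-1) ^ (n + 1) * iteratedDeriv (n + 1) φ t) := by
  have hsub : uIcc R x ⊆ Ioi 0 := by
    rw [uIcc_of_ge hxR.le]
    exact fun t ht => hx.trans_le ht.1
  have hu : UniqueDiffOn ℝ (uIcc R x) := uniqueDiffOn_uIcc hxR.ne'
  have hd : ∀ k : ℕ, ∀ t ∈ uIcc R x, iteratedDerivWithin k φ (uIcc R x) t = iteratedDeriv k φ t :=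
    fun k t ht => iteratedDerivWithin_eq_iteratedDeriv hu
      (contDiffAt_of_contDiffOn_Ioi h (hsub ht) k) ht
  have h1 := taylor_integral_remainder (f := φ) (x₀ := R) (x := x) (n := n)
    ((h.mono hsub).of_le (mod_cast le_top))
  rw [taylor_within_apply, intervalIntegral.integral_symm] at h1
  have h2 : ∫ t in x..R, (t - x) ^ n / (n.factorial : ℝ) *
      ((-1) ^ (n + 1) * iteratedDeriv (n + 1) φ t) =
      -∫ t in x..R, ((x - t) ^ n / (n.factorial : ℝ)) •
        iteratedDerivWithin (n + 1) φ (uIcc R x) t := by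
    rw [← intervalIntegral.integral_neg]
    refine intervalIntegral.integral_congr fun t ht => ?_
    rw [uIcc_comm] at ht
    simp only [smul_eq_mul]
    rw [hd _ _ ht, ← neg_sub t x, neg_pow (t - x)]
    ring
  rw [h2, ← h1]
  congr 1
  refine Finset.sum_congr rfl fun k _ => ?_
  rw [hd _ _ left_mem_uIcc, ← neg_sub R x, neg_pow (R - x), smul_eq_mul]
  ring

theorem continuousOn_taylor_integrand {φ : ℝ → ℝ} (h : ContDiffOn ℝ ∞ φ (Ioi 0)) {x R : ℝ}
    (hx : 0 < x) (y : ℝ) (n : ℕ) :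
    ContinuousOn (fun t => (t - y) ^ n / (n.factorial : ℝ) *
      ((-1) ^ (n + 1) * iteratedDeriv (n + 1) φ t)) (Icc x R) := by
  have : ContinuousOn (iteratedDeriv (n + 1) φ) (Icc x R) := fun t ht =>
    (differentiableAt_iteratedDeriv h (hx.trans_le ht.1) _).continuousAt.continuousWithinAt
  fun_prop

theorem taylor_remainder_nonneg {φ : ℝ → ℝ} (h : IsCompletelyMonotone φ) {x R : ℝ}
    (hx : 0 < x) (hxR : x < R) (n : ℕ) :
    0 ≤ ∫ t in x..R, (t - x) ^ n / (n.factorial : ℝ) *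
      ((-1) ^ (n + 1) * iteratedDeriv (n + 1) φ t) :=
  intervalIntegral.integral_nonneg hxR.le fun t ht =>
    mul_nonneg (div_nonneg (pow_nonneg (sub_nonneg.2 ht.1) _) (by positivity))
      (h.2 _ _ (hx.trans_le ht.1))

/-- The quotient (t - x)/(t - y) increases in t, so on [x, R] it is at most its value at R.
Enlarging the domain of integration to [y, R] only adds a nonnegative amount. -/
theorem taylor_remainder_le {φ : ℝ → ℝ} (h : IsCompletelyMonotone φ) {x y R : ℝ}
    (hy : 0 < y) (hyx : y < x) (hxR : x < R) (n : ℕ) :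
    ∫ t in x..R, (t - x) ^ n / (n.factorial : ℝ) *
      ((-1) ^ (n + 1) * iteratedDeriv (n + 1) φ t) ≤
    ((R - x) / (R - y)) ^ n * ∫ t in y..R, (t - y) ^ n / (n.factorial : ℝ) *
      ((-1) ^ (n + 1) * iteratedDeriv (n + 1) φ t) := by
  have hx := hy.trans hyx
  have hRy : 0 < R - y := by linarith
  set q := (R - x) / (R - y) with hq
  have hq0 : 0 ≤ q := div_nonneg (by linarith) hRy.le
  set u : ℝ → ℝ := fun t => (t - y) ^ n / (n.factorial : ℝ) *
      ((-1) ^ (n + 1) * iteratedDeriv (n + 1) φ t) with hu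
  have hi : ∀ a b, 0 < a → a ≤ b → IntervalIntegrable u volume a b := fun a b ha hab =>
    ((continuousOn_taylor_integrand h.1 (R := b) ha y n).mono
      (by rw [uIcc_of_le hab])).intervalIntegrable
  have h1 : ∫ t in x..R, (t - x) ^ n / (n.factorial : ℝ) *
      ((-1) ^ (n + 1) * iteratedDeriv (n + 1) φ t) ≤ ∫ t in x..R, q ^ n * u t := by
    refine intervalIntegral.integral_mono_on hxR.le
      (((continuousOn_taylor_integrand h.1 (R := R) hx x n).mono
        (by rw [uIcc_of_le hxR.le])).intervalIntegrable) ((hi x R hx hxR.le).const_mul _) ?_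
    intro t ht
    have h0 := h.2 (n + 1) t (hx.trans_le ht.1)
    have h2 : t - x ≤ q * (t - y) := by
      rw [hq, div_mul_eq_mul_div, le_div_iff₀ hRy]
      nlinarith [ht.1, ht.2]
    have h3 : (t - x) ^ n ≤ q ^ n * (t - y) ^ n := by
      rw [← mul_pow]
      exact pow_le_pow_left₀ (sub_nonneg.2 ht.1) h2 n
    calc _ ≤ (q ^ n * (t - y) ^ n) / (n.factorial : ℝ) *
          ((-1) ^ (n + 1) * iteratedDeriv (n + 1) φ t) := by gcongr
      _ = _ := by rw [hu]; ring
  refine h1.trans ?_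
  rw [intervalIntegral.integral_const_mul]
  refine mul_le_mul_of_nonneg_left ?_ (pow_nonneg hq0 n)
  rw [← intervalIntegral.integral_add_adjacent_intervals (hi y x hy hyx.le) (hi x R hx hxR.le)]
  refine le_add_of_nonneg_left (intervalIntegral.integral_nonneg hyx.le fun t ht => ?_)
  exact mul_nonneg (div_nonneg (pow_nonneg (sub_nonneg.2 ht.1) _) (by positivity))
      (h.2 _ _ (hy.trans_le ht.1))

theorem IsCompletelyMonotone.taylor_term_nonneg {φ : ℝ → ℝ} (h : IsCompletelyMonotone φ)
    {x R : ℝ} (hR : 0 < R) (hxR : x ≤ R) (k : ℕ) :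
    0 ≤ (R - x) ^ k / (k.factorial : ℝ) * ((-1) ^ k * iteratedDeriv k φ R) :=
  mul_nonneg (div_nonneg (pow_nonneg (sub_nonneg.2 hxR) _) (by positivity)) (h.2 _ _ hR)

theorem IsCompletelyMonotone.taylor_sum_le {φ : ℝ → ℝ} (h : IsCompletelyMonotone φ) {x R : ℝ}
    (hx : 0 < x) (hxR : x < R) (n : ℕ) :
    ∑ k ∈ Finset.range n, (R - x) ^ k / (k.factorial : ℝ) * ((-1) ^ k * iteratedDeriv k φ R)
      ≤ φ x := by
  have h1 := taylor_remainder_nonneg h hx hxR n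
  rw [← taylor_remainder_alternating h.1 hx hxR, sub_nonneg, Finset.sum_range_succ] at h1
  exact le_trans (le_add_of_nonneg_right (h.taylor_term_nonneg (hx.trans hxR) hxR.le n)) h1

/-- The Taylor series of a completely monotone function at `R` converges to it on `(0, R)`. -/
theorem IsCompletelyMonotone.hasSum_taylor {φ : ℝ → ℝ} (h : IsCompletelyMonotone φ) {x R : ℝ}
    (hx : 0 < x) (hxR : x < R) :
    HasSum (fun k : ℕ => (R - x) ^ k / (k.factorial : ℝ) * ((-1) ^ k * iteratedDeriv k φ R))
      (φ x) := by
  rw [hasSum_iff_tendsto_nat_of_nonneg (fun k => h.taylor_term_nonneg (hx.trans hxR) hxR.le k)]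
  rw [← tendsto_add_atTop_iff_nat 1]
  -- Any point of (0, x) would do: the remainder there is at most the value of `φ`, uniformly in n,
  -- so the remainder at x decays geometrically.
  have hy : 0 < x / 2 := by linarith
  have hyx : x / 2 < x := by linarith
  set q := (R - x) / (R - x / 2) with hq
  have hq0 : 0 ≤ q := div_nonneg (by linarith) (by linarith)
  have hq1 : q < 1 := by rw [hq, div_lt_one (by linarith)]; linarith
  have hlow : Tendsto (fun n : ℕ => φ x - q ^ n * φ (x / 2)) atTop (𝓝 (φ x)) := by
    simpa using ((tendsto_pow_atTop_nhds_zero_of_lt_one hq0 hq1).mul_const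
      (φ (x / 2))).const_sub (φ x)
  refine tendsto_of_tendsto_of_tendsto_of_le_of_le hlow tendsto_const_nhds (fun n => ?_)
    (fun n => h.taylor_sum_le hx hxR _)
  have h1 := taylor_remainder_le h hy hyx hxR n
  rw [← taylor_remainder_alternating h.1 hx hxR,
    ← taylor_remainder_alternating h.1 hy (hyx.trans hxR)] at h1
  have h2 : 0 ≤ ∑ k ∈ Finset.range (n + 1),
      (R - x / 2) ^ k / (k.factorial : ℝ) * ((-1) ^ k * iteratedDeriv k φ R) :=
    Finset.sum_nonneg fun k _ => h.taylor_term_nonneg (hx.trans hxR) (hyx.trans hxR).le k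
  have h3 := mul_le_mul_of_nonneg_left (sub_le_self (φ (x / 2)) h2) (pow_nonneg hq0 n)
  change φ x - q ^ n * φ (x / 2) ≤ _
  linarith

/-- Let x → 0+ in the bound for partial sums. This bounds the total mass of the Taylor coefficients
independently of R. -/
theorem IsCompletelyMonotone.taylor_zero_sum_le {φ : ℝ → ℝ} (h : IsCompletelyMonotone φ) {C R : ℝ}
    (hC : ∀ t, 0 < t → φ t ≤ C) (hR : 0 < R) (n : ℕ) :
    ∑ k ∈ Finset.range n, R ^ k / (k.factorial : ℝ) * ((-1) ^ k * iteratedDeriv k φ R) ≤ C := by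
  have ht : Tendsto (fun x => ∑ k ∈ Finset.range n,
      (R - x) ^ k / (k.factorial : ℝ) * ((-1) ^ k * iteratedDeriv k φ R)) (𝓝[>] 0)
      (𝓝 (∑ k ∈ Finset.range n,
        (R - 0) ^ k / (k.factorial : ℝ) * ((-1) ^ k * iteratedDeriv k φ R))) :=
    (Continuous.tendsto (by fun_prop) 0).mono_left nhdsWithin_le_nhds
  rw [sub_zero] at ht
  refine le_of_tendsto ht ?_
  filter_upwards [Ioo_mem_nhdsGT hR] with x hx
  exact (h.taylor_sum_le hx.1 hx.2 n).trans (hC x hx.1)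

/-! ### Bernstein's theorem -/

theorem continuous_rpow_unitInterval {c : ℝ} (hc : 0 < c) :
    Continuous fun u : unitInterval => (u : ℝ) ^ c :=
  continuous_subtype_val.rpow_const fun _ => Or.inr hc.le

/-- The point `exp (-(k / R))` of the unit interval. -/
def expPoint (R : ℝ) (hR : 0 < R) (k : ℕ) : unitInterval :=
  ⟨Real.exp (-(k / R)), (Real.exp_pos _).le, by
    rw [Real.exp_le_one_iff, neg_nonpos]; positivity⟩

/-- The Taylor coefficients of `φ` at `R` as a discrete measure on the unit interval. -/
def taylorMeasure (φ : ℝ → ℝ) (R : ℝ) (hR : 0 < R) : Measure unitInterval :=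
  Measure.sum fun k : ℕ =>
    ENNReal.ofReal (R ^ k / (k.factorial : ℝ) * ((-1) ^ k * iteratedDeriv k φ R)) •
      Measure.dirac (expPoint R hR k)

theorem taylorMeasure_univ_le {φ : ℝ → ℝ} (h : IsCompletelyMonotone φ) {C R : ℝ}
    (hC : ∀ t, 0 < t → φ t ≤ C) (hR : 0 < R) :
    taylorMeasure φ R hR univ ≤ ENNReal.ofReal C := by
  rw [taylorMeasure, Measure.sum_apply _ MeasurableSet.univ]
  simp only [Measure.smul_apply, measure_univ, smul_eq_mul, mul_one]
  refine ENNReal.tsum_le_of_sum_range_le fun n => ?_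
  rw [← ENNReal.ofReal_sum_of_nonneg fun k _ => ?_]
  · exact ENNReal.ofReal_le_ofReal (h.taylor_zero_sum_le hC hR n)
  · simpa using h.taylor_term_nonneg hR hR.le k

theorem integral_rpow_taylorMeasure {φ : ℝ → ℝ} (h : IsCompletelyMonotone φ) {C R c : ℝ}
    (hC : ∀ t, 0 < t → φ t ≤ C) (hR : 0 < R) (hc : 0 < c) :
    ∫ u, (u : ℝ) ^ c ∂taylorMeasure φ R hR = φ (R * (1 - Real.exp (-(c / R)))) := by
  have hfin : IsFiniteMeasure (taylorMeasure φ R hR) :=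
    ⟨(taylorMeasure_univ_le h hC hR).trans_lt ENNReal.ofReal_lt_top⟩
  have hint : Integrable (fun u : unitInterval => (u : ℝ) ^ c) (taylorMeasure φ R hR) := by
    refine Integrable.of_bound (continuous_rpow_unitInterval hc).aestronglyMeasurable 1
      (Eventually.of_forall fun u => ?_)
    rw [Real.norm_of_nonneg (Real.rpow_nonneg u.2.1 _)]
    exact Real.rpow_le_one u.2.1 u.2.2 hc.le
  have h1 := hasSum_integral_measure (μ := fun k : ℕ =>
    ENNReal.ofReal (R ^ k / (k.factorial : ℝ) * ((-1) ^ k * iteratedDeriv k φ R)) •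
      Measure.dirac (expPoint R hR k)) hint
  have he : Real.exp (-(c / R)) < 1 := by
    rw [Real.exp_lt_one_iff, neg_lt_zero]; positivity
  have hx : 0 < R * (1 - Real.exp (-(c / R))) := mul_pos hR (by linarith)
  have hxR : R * (1 - Real.exp (-(c / R))) < R := by
    have := mul_pos hR (Real.exp_pos (-(c / R)))
    linarith
  -- The k-th atom contributes its mass times exp(-c/R)^k, so the integral is the Taylor series at
  -- the point x with R - x = R exp(-c/R).
  refine h1.unique ((h.hasSum_taylor hx hxR).congr_fun fun k => ?_)
  have h0 : 0 ≤ R ^ k / (k.factorial : ℝ) * ((-1) ^ k * iteratedDeriv k φ R) := by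
    simpa using h.taylor_term_nonneg hR hR.le k
  rw [integral_smul_measure, integral_dirac, ENNReal.toReal_ofReal h0, smul_eq_mul]
  have h2 : ((expPoint R hR k : unitInterval) : ℝ) ^ c = Real.exp (-(c / R)) ^ k := by
    change (Real.exp (-(k / R))) ^ c = _
    rw [← Real.exp_mul, ← Real.exp_nat_mul]
    congr 1
    ring
  rw [h2]
  have h3 : R - R * (1 - Real.exp (-(c / R))) = R * Real.exp (-(c / R)) := by ring
  rw [h3, mul_pow]
  ring

theorem tendsto_mul_one_sub_exp (c : ℝ) :
    Tendsto (fun n : ℕ => ((n : ℝ) + 1) * (1 - Real.exp (-(c / ((n : ℝ) + 1))))) atTop (𝓝 c) := by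
  have h1 : HasDerivAt (fun s : ℝ => 1 - Real.exp (-(c * s))) c 0 := by
    have := (((hasDerivAt_id (0 : ℝ)).const_mul c).neg.exp).const_sub 1
    simpa using this
  have h2 := h1.tendsto_slope_zero
  have h3 : Tendsto (fun n : ℕ => ((n : ℝ) + 1)⁻¹) atTop (𝓝[≠] 0) := by
    refine tendsto_nhdsWithin_iff.2 ⟨?_, Eventually.of_forall fun n => ?_⟩
    · simpa using tendsto_one_div_add_atTop_nhds_zero_nat (𝕜 := ℝ)
    · exact inv_ne_zero (by positivity)
  refine (h2.comp h3).congr fun n => ?_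
  simp [div_eq_mul_inv]

/-- Measures of mass at most C on the compact interval form a weakly compact set, so the Taylor
measures for R = n + 1 have a limit along an ultrafilter. Their moments of order c are `φ` at R(1 -
exp(-c/R)), which tends to c. -/
theorem IsCompletelyMonotone.exists_measure_unitInterval {φ : ℝ → ℝ}
    (h : IsCompletelyMonotone φ) {C : ℝ} (hC : ∀ t, 0 < t → φ t ≤ C) :
    ∃ ν : Measure unitInterval, IsFiniteMeasure ν ∧
      ∀ c : ℝ, 0 < c → φ c = ∫ u, (u : ℝ) ^ c ∂ν := by
  have hpos : ∀ n : ℕ, (0 : ℝ) < n + 1 := fun n => by positivity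
  have hfin : ∀ n : ℕ, IsFiniteMeasure (taylorMeasure φ (n + 1) (hpos n)) := fun n =>
    ⟨(taylorMeasure_univ_le h hC (hpos n)).trans_lt ENNReal.ofReal_lt_top⟩
  let m : ℕ → FiniteMeasure unitInterval := fun n => ⟨taylorMeasure φ (n + 1) (hpos n), hfin n⟩
  have hm : ∀ n, m n ∈ {μ : FiniteMeasure unitInterval | μ.mass ≤ C.toNNReal} := fun n => by
    change (m n).mass ≤ C.toNNReal
    rw [← ENNReal.coe_le_coe, FiniteMeasure.ennreal_mass]
    exact taylorMeasure_univ_le h hC (hpos n)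
  obtain ⟨ν, -, hν⟩ := (isCompact_setOfPred_finiteMeasure_le_of_compactSpace unitInterval
    C.toNNReal).ultrafilter_le_nhds ((Filter.hyperfilter ℕ : Ultrafilter ℕ).map m)
    (by
      rw [le_principal_iff]
      exact Filter.mem_map.2 (Eventually.of_forall hm))
  refine ⟨ν, inferInstance, fun c hc => ?_⟩
  have ht : Tendsto m (Filter.hyperfilter ℕ : Filter ℕ) (𝓝 ν) := hν
  rw [FiniteMeasure.tendsto_iff_forall_integral_tendsto] at ht
  have h1 := ht (BoundedContinuousFunction.mkOfCompact ⟨_, continuous_rpow_unitInterval hc⟩)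
  refine tendsto_nhds_unique ?_ h1
  have h2 : Tendsto (fun n : ℕ => φ (((n : ℝ) + 1) * (1 - Real.exp (-(c / ((n : ℝ) + 1))))))
      atTop (𝓝 (φ c)) :=
    ((contDiffAt_of_contDiffOn_Ioi h.1 hc 0).continuousAt.tendsto).comp (tendsto_mul_one_sub_exp c)
  refine (h2.mono_left ?_).congr fun n => (integral_rpow_taylorMeasure h hC (hpos n) hc).symm
  rw [← Nat.cofinite_eq_atTop]
  exact Filter.hyperfilter_le_cofinite

/-- **Bernstein's theorem** for bounded completely monotone functions. -/
theorem IsCompletelyMonotone.exists_measure {φ : ℝ → ℝ}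
    (h : IsCompletelyMonotone φ) {C : ℝ} (hC : ∀ t, 0 < t → φ t ≤ C) :
    ∃ p : Measure ℝ≥0, IsFiniteMeasure p ∧
      ∀ c : ℝ, 0 < c → φ c = ∫ s, Real.exp (-(c * s)) ∂p := by
  obtain ⟨ν, hν, hφ⟩ := h.exists_measure_unitInterval hC
  -- Substitute u = exp(-s). A possible atom at u = 0 is discarded; it contributes nothing because
  -- 0^c = 0 for c > 0.
  have hS : MeasurableSet {u : unitInterval | 0 < (u : ℝ)} :=
    measurableSet_lt measurable_const measurable_subtype_coe
  have hg : Measurable fun u : unitInterval => (-Real.log u).toNNReal :=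
    (Real.measurable_log.comp measurable_subtype_coe).neg.real_toNNReal
  refine ⟨(ν.restrict {u : unitInterval | 0 < (u : ℝ)}).map
    fun u : unitInterval => (-Real.log u).toNNReal, inferInstance,
    fun c hc => ?_⟩
  rw [integral_map hg.aemeasurable (Continuous.aestronglyMeasurable (by fun_prop)), hφ c hc,
    ← setIntegral_eq_integral_of_forall_compl_eq_zero (s := {u : unitInterval | 0 < (u : ℝ)})]
  · refine setIntegral_congr_fun hS fun u hu => ?_
    have hl : 0 ≤ -Real.log u := neg_nonneg.2 (Real.log_nonpos u.2.1 u.2.2)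
    simp only [Real.coe_toNNReal _ hl]
    rw [Real.rpow_def_of_pos hu]
    congr 1
    ring
  · intro u hu
    have : (u : ℝ) = 0 := le_antisymm (not_lt.1 hu) u.2.1
    rw [this, Real.zero_rpow hc.ne']

/-! ### Representation of Bernstein functions -/

theorem IsBernstein.isCompletelyMonotone_deriv_shift {f : ℝ → ℝ} (h : IsBernstein f) :
    IsCompletelyMonotone fun t => deriv f (1 + t) := by
  refine ⟨h.2.2.1.comp (by fun_prop) fun t ht => ?_, fun n t ht => ?_⟩
  · exact add_pos one_pos (mem_Ioi.1 ht)
  · rw [iteratedDeriv_comp_const_add]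
    exact h.2.2.2 n _ (by linarith)

theorem IsBernstein.monotoneOn_iteratedDeriv {f : ℝ → ℝ} (h : IsBernstein f) (n : ℕ) :
    MonotoneOn (fun t => (-1) ^ n * iteratedDeriv n f t) (Ioi 0) := by
  refine monotoneOn_of_deriv_nonneg (convex_Ioi 0) (fun t ht => ?_) (fun t ht => ?_)
    (fun t ht => ?_)
  · exact ((differentiableAt_iteratedDeriv h.1 ht n).const_mul _).continuousAt.continuousWithinAt
  · rw [interior_Ioi] at ht
    exact ((differentiableAt_iteratedDeriv h.1 ht n).const_mul _).differentiableWithinAt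
  · rw [interior_Ioi] at ht
    rw [deriv_const_mul _ (differentiableAt_iteratedDeriv h.1 ht n), ← iteratedDeriv_succ,
      iteratedDeriv_succ']
    exact h.2.2.2 n t ht

theorem IsBernstein.monotoneOn {f : ℝ → ℝ} (h : IsBernstein f) : MonotoneOn f (Ioi 0) := by
  simpa using h.monotoneOn_iteratedDeriv 0

/-- Each (-1)^n f^(n) has derivative (-1)^n (f')^(n) ≥ 0, hence does not decrease under the shift by
1. -/
theorem IsBernstein.isCompletelyMonotone_sub_shift {f : ℝ → ℝ} (h : IsBernstein f) :
    IsCompletelyMonotone fun t => f (1 + t) - f t := by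
  have hc : ContDiffOn ℝ ∞ (fun t => f (1 + t)) (Ioi 0) :=
    h.1.comp (by fun_prop) fun t ht => mem_Ioi.2 (add_pos one_pos (mem_Ioi.1 ht))
  refine ⟨hc.sub h.1, fun n t ht => ?_⟩
  rw [iteratedDeriv_fun_sub (contDiffAt_of_contDiffOn_Ioi hc ht n)
    (contDiffAt_of_contDiffOn_Ioi h.1 ht n), iteratedDeriv_comp_const_add, mul_sub, sub_nonneg]
  exact h.monotoneOn_iteratedDeriv n ht (mem_Ioi.2 (add_pos one_pos ht)) (by linarith)

theorem IsCompletelyMonotone.antitoneOn {φ : ℝ → ℝ} (h : IsCompletelyMonotone φ) :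
    AntitoneOn φ (Ioi 0) := by
  refine antitoneOn_of_deriv_nonpos (convex_Ioi 0) h.1.continuousOn ?_ (fun t ht => ?_)
  · rw [interior_Ioi]
    exact h.1.differentiableOn (by simp)
  · rw [interior_Ioi] at ht
    have := h.2 1 t ht
    rw [iteratedDeriv_one] at this
    linarith

theorem IsBernstein.sub_shift_le {f : ℝ → ℝ} (h : IsBernstein f) (t : ℝ) (ht : 0 < t) :
    f (1 + t) - f t ≤ f 2 := by
  have h1 : ∀ s, 0 < s → s ≤ 1 → f (1 + s) - f s ≤ f 2 := fun s hs hs1 => by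
    have h2 := h.monotoneOn (a := 1 + s) (b := 2) (mem_Ioi.2 (add_pos one_pos hs)) (by simp) (by linarith)
    have h3 := h.2.1 s hs
    linarith
  rcases le_total t 1 with ht1 | ht1
  · exact h1 t ht ht1
  · exact (h.isCompletelyMonotone_sub_shift.antitoneOn (mem_Ioi.2 one_pos) ht ht1).trans
      (h1 1 one_pos le_rfl)

theorem norm_exp_neg_mul_le_one {c : ℝ} (hc : 0 ≤ c) (s : ℝ≥0) :
    ‖Real.exp (-(c * s))‖ ≤ 1 := by
  rw [Real.norm_of_nonneg (Real.exp_pos _).le, Real.exp_le_one_iff, neg_nonpos]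
  positivity

/-- The increment equals c ∫_0^1 f'(1 + cu) du, and f'(1 + ·) is bounded and completely monotone,
hence the Laplace transform of some finite ρ. The measure p is the image of Lebesgue measure on (0,
1] times ρ under (u, s) ↦ us. -/
theorem IsBernstein.exists_measure_shift {f : ℝ → ℝ} (h : IsBernstein f) :
    ∃ p : Measure ℝ≥0, IsFiniteMeasure p ∧
      ∀ c : ℝ, 0 < c → f (1 + c) - f 1 = c * ∫ s, Real.exp (-(c * s)) ∂p := by
  obtain ⟨ρ, hρ, hf⟩ := h.isCompletelyMonotone_deriv_shift.exists_measure
    (C := deriv f 1) fun t ht => h.2.2.antitoneOn (mem_Ioi.2 one_pos)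
      (mem_Ioi.2 (by linarith)) (by linarith)
  have hg : Measurable fun q : ℝ × ℝ≥0 => q.1.toNNReal * q.2 := by fun_prop
  refine ⟨((volume.restrict (Ioc (0 : ℝ) 1)).prod ρ).map fun q => q.1.toNNReal * q.2,
    inferInstance, fun c hc => ?_⟩
  have hd : ∀ u ∈ uIcc (0 : ℝ) 1,
      HasDerivAt (fun u => f (1 + c * u)) (c * deriv f (1 + c * u)) u := fun u hu => by
    rw [uIcc_of_le zero_le_one] at hu
    have hpos : 0 < 1 + c * u := by have := mul_nonneg hc.le hu.1; linarith
    have h1 := (contDiffAt_of_contDiffOn_Ioi h.1 hpos 1).differentiableAt (by simp)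
    have h2 : HasDerivAt (fun u => 1 + c * u) c u := by
      simpa using ((hasDerivAt_id u).const_mul c).const_add 1
    have h3 := h1.hasDerivAt.comp u h2
    rw [mul_comm] at h3
    exact h3
  have hcont : ContinuousOn (fun u => c * deriv f (1 + c * u)) (uIcc 0 1) := by
    rw [uIcc_of_le zero_le_one]
    refine continuousOn_const.mul (h.2.2.1.continuousOn.comp (by fun_prop) fun u hu => ?_)
    have := mul_nonneg hc.le hu.1
    exact mem_Ioi.2 (by linarith)
  have h1 := intervalIntegral.integral_eq_sub_of_hasDerivAt hd hcont.intervalIntegrable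
  rw [integral_map hg.aemeasurable (Continuous.aestronglyMeasurable (by fun_prop)),
    integral_prod _ (Integrable.of_bound (Continuous.aestronglyMeasurable (by fun_prop)) 1
      (Eventually.of_forall fun q => norm_exp_neg_mul_le_one hc.le _))]
  rw [intervalIntegral.integral_const_mul, intervalIntegral.integral_of_le zero_le_one] at h1
  rw [mul_one, mul_zero, add_zero] at h1
  rw [← h1]
  congr 1
  refine setIntegral_congr_fun measurableSet_Ioc fun u hu => ?_
  simp only
  rw [hf _ (mul_pos hc hu.1)]
  refine integral_congr_ae (Eventually.of_forall fun s => ?_)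
  simp only [NNReal.coe_mul, Real.coe_toNNReal _ hu.1.le]
  rw [mul_assoc]

/-- A Bernstein function is `a + t K(t) - D(t)` for Laplace transforms `K`, `D` of finite
measures. -/
theorem IsBernstein.exists_representation {f : ℝ → ℝ} (h : IsBernstein f) :
    ∃ (a : ℝ) (p q : Measure ℝ≥0), IsFiniteMeasure p ∧ IsFiniteMeasure q ∧ ∀ c : ℝ, 0 < c →
      f c = a + c * ∫ s, Real.exp (-(c * s)) ∂p - ∫ s, Real.exp (-(c * s)) ∂q := by
  obtain ⟨p, hp, h1⟩ := h.exists_measure_shift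
  obtain ⟨q, hq, h2⟩ := h.isCompletelyMonotone_sub_shift.exists_measure h.sub_shift_le
  -- Here f(c) = f(1) + (f(1+c) - f(1)) - (f(1+c) - f(c)).
  refine ⟨f 1, p, q, hp, hq, fun c hc => ?_⟩
  rw [← h1 c hc, ← h2 c hc]
  ring

/-! ### Complex measures as combinations of finite measures -/

section Integral

theorem integrable_of_bounded {X : Type*} [NormedAddCommGroup X] (μ : ComplexMeasure ℝ≥0) {f : ℝ≥0 → X} (hf : Continuous f) {C : ℝ}
    (hC : ∀ t, ‖f t‖ ≤ C) : μ.Integrable f := by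
  have := isFiniteMeasure_variation μ
  exact Integrable.of_bound hf.aestronglyMeasurable C (Eventually.of_forall hC)

theorem integrable_simpleFunc {X : Type*} [NormedAddCommGroup X] (μ : ComplexMeasure ℝ≥0) (f : SimpleFunc ℝ≥0 X) :
    μ.Integrable f := by
  have := isFiniteMeasure_variation μ
  exact f.integrable_of_isFiniteMeasure

variable {X : Type*} [NormedAddCommGroup X] [NormedSpace ℂ X]

/-- A finite measure as a complex measure. -/
def ofFinite (p : Measure ℝ≥0) [IsFiniteMeasure p] : ComplexMeasure ℝ≥0 :=
  p.toSignedMeasure.toComplexMeasure 0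

theorem ofFinite_apply (p : Measure ℝ≥0) [IsFiniteMeasure p] {s : Set ℝ≥0}
    (hs : MeasurableSet s) : ofFinite p s = (p.real s : ℂ) := by
  rw [ofFinite, SignedMeasure.toComplexMeasure_apply, Measure.toSignedMeasure_apply_measurable hs]
  rfl

/-- Jordan decomposition of the real and imaginary parts; it reduces Fubini and uniqueness questions
to finite positive measures. -/
theorem eq_combination_ofFinite (μ : ComplexMeasure ℝ≥0) :
    μ = (ofFinite (ComplexMeasure.re μ).toJordanDecomposition.posPart -
        ofFinite (ComplexMeasure.re μ).toJordanDecomposition.negPart) +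
      Complex.I • (ofFinite (ComplexMeasure.im μ).toJordanDecomposition.posPart -
        ofFinite (ComplexMeasure.im μ).toJordanDecomposition.negPart) := by
  have key : ∀ (σ : SignedMeasure ℝ≥0) (s : Set ℝ≥0), MeasurableSet s →
      ofFinite σ.toJordanDecomposition.posPart s - ofFinite σ.toJordanDecomposition.negPart s =
        (σ s : ℂ) := fun σ s hs => by
    rw [ofFinite_apply _ hs, ofFinite_apply _ hs, ← Complex.ofReal_sub,
      ← SignedMeasure.apply_eq_posPart_real_sub_negPart_real σ hs]
  refine VectorMeasure.ext fun s hs => ?_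
  simp only [add_apply, sub_apply, smul_apply]
  rw [key _ s hs, key _ s hs, smul_eq_mul, mul_comm]
  exact (Complex.re_add_im (μ s)).symm

theorem cintegral_add_measure (μ ν : ComplexMeasure ℝ≥0) {f : ℝ≥0 → X} (hf : Continuous f) {C : ℝ}
    (hC : ∀ t, ‖f t‖ ≤ C) : cintegral (μ + ν) f = cintegral μ f + cintegral ν f :=
  VectorMeasure.integral_add_vectorMeasure (integrable_of_bounded μ hf hC)
    (integrable_of_bounded ν hf hC)

variable [CompleteSpace X]

/-- A functional with the values of `cintegral μ` on indicators, which is additive on simple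
functions and satisfies bounded convergence, is `cintegral μ`. -/
theorem cintegral_eq_of_indicator {μ : ComplexMeasure ℝ≥0} {S : (ℝ≥0 → X) → X}
    (hind : ∀ s, MeasurableSet s → ∀ x : X, S (s.indicator fun _ => x) = μ s • x)
    (hadd : ∀ f g : SimpleFunc ℝ≥0 X, S (f + g) = S f + S g)
    (hlim : ∀ (F : ℕ → SimpleFunc ℝ≥0 X) (f : ℝ≥0 → X) (C : ℝ), (∀ n t, ‖F n t‖ ≤ C) →
      (∀ t, Tendsto (fun n => F n t) atTop (𝓝 (f t))) →
      Tendsto (fun n => S (F n)) atTop (𝓝 (S f)))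
    {f : ℝ≥0 → X} (hf : Continuous f) {C : ℝ} (hC : ∀ t, ‖f t‖ ≤ C) :
    cintegral μ f = S f := by
  classical
  have := isFiniteMeasure_variation μ
  have hsimple : ∀ g : SimpleFunc ℝ≥0 X, cintegral μ g = S g := by
    intro g
    induction g using SimpleFunc.induction with
    | const x hs =>
      rw [SimpleFunc.coe_piecewise, SimpleFunc.coe_const, SimpleFunc.coe_const]
      have h0 : Function.const ℝ≥0 (0 : X) = 0 := rfl
      rw [h0, piecewise_eq_indicator]
      refine Eq.trans ?_ (hind _ hs x).symm
      exact VectorMeasure.integral_indicator_const x hs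
    | @add g1 g2 _ h1 h2 =>
      rw [SimpleFunc.coe_add, hadd, ← h1, ← h2]
      exact VectorMeasure.integral_add (integrable_simpleFunc μ g1) (integrable_simpleFunc μ g2)
  have hsm : StronglyMeasurable f := hf.stronglyMeasurable
  have hC0 : 0 ≤ C := (norm_nonneg _).trans (hC 0)
  have hb : ∀ n t, ‖hsm.approxBounded C n t‖ ≤ C := fun n t =>
    hsm.norm_approxBounded_le hC0 n t
  have ht : ∀ t, Tendsto (fun n => hsm.approxBounded C n t) atTop (𝓝 (f t)) := fun t =>
    hsm.tendsto_approxBounded_of_norm_le (hC t)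
  refine tendsto_nhds_unique ?_ (hlim _ f C hb ht)
  simp only [← hsimple]
  exact VectorMeasure.tendsto_integral_filter_of_norm_le_const
    (Eventually.of_forall fun n => (SimpleFunc.stronglyMeasurable _).aestronglyMeasurable)
    ⟨C, Eventually.of_forall fun n => Eventually.of_forall (hb n)⟩ (Eventually.of_forall ht)

theorem cintegral_ofFinite (p : Measure ℝ≥0) [IsFiniteMeasure p] {f : ℝ≥0 → X}
    (hf : Continuous f) {C : ℝ} (hC : ∀ t, ‖f t‖ ≤ C) :
    cintegral (ofFinite p) f = ∫ t, f t ∂p := by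
  refine cintegral_eq_of_indicator (S := fun f => ∫ t, f t ∂p) (fun s hs x => ?_) (fun f g => ?_)
    (fun F f C hb ht => ?_) hf hC
  · rw [integral_indicator_const x hs, ofFinite_apply p hs, Complex.coe_smul]
  · exact integral_add f.integrable_of_isFiniteMeasure g.integrable_of_isFiniteMeasure
  · exact tendsto_integral_filter_of_norm_le_const
      (Eventually.of_forall fun n => (SimpleFunc.stronglyMeasurable _).aestronglyMeasurable)
      ⟨C, Eventually.of_forall fun n => Eventually.of_forall (hb n)⟩ (Eventually.of_forall ht)

theorem cintegral_smul_measure (c : ℂ) (μ : ComplexMeasure ℝ≥0) {f : ℝ≥0 → X}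
    (hf : Continuous f) {C : ℝ} (hC : ∀ t, ‖f t‖ ≤ C) :
    cintegral (c • μ) f = c • cintegral μ f := by
  have := isFiniteMeasure_variation μ
  refine cintegral_eq_of_indicator (S := fun f => c • cintegral μ f) (fun s hs x => ?_)
    (fun f g => ?_) (fun F f C hb ht => ?_) hf hC
  · have : cintegral μ (s.indicator fun _ => x) = μ s • x :=
      VectorMeasure.integral_indicator_const x hs
    rw [this, smul_apply, smul_smul, smul_eq_mul]
  · rw [← smul_add]
    congr 1
    exact VectorMeasure.integral_add (integrable_simpleFunc μ f) (integrable_simpleFunc μ g)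
  · exact (VectorMeasure.tendsto_integral_filter_of_norm_le_const
      (Eventually.of_forall fun n => (SimpleFunc.stronglyMeasurable _).aestronglyMeasurable)
      ⟨C, Eventually.of_forall fun n => Eventually.of_forall (hb n)⟩
      (Eventually.of_forall ht)).const_smul c

end Integral

/-! ### Laplace transforms and the Hille-Phillips calculus -/

/-- The kernel of the Laplace transform. -/
abbrev expKernel (z : ℂ) (t : ℝ≥0) : ℂ := Complex.exp (-(z * ((t : ℝ) : ℂ)))

theorem continuous_expKernel (z : ℂ) : Continuous (expKernel z) := by
  unfold expKernel
  fun_prop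

theorem norm_expKernel_le {z : ℂ} (hz : 0 ≤ z.re) (t : ℝ≥0) : ‖expKernel z t‖ ≤ 1 := by
  rw [expKernel, Complex.norm_exp, Real.exp_le_one_iff]
  simp only [Complex.neg_re, Complex.mul_re, Complex.ofReal_re, Complex.ofReal_im, mul_zero,
    sub_zero, neg_nonpos]
  positivity

theorem expKernel_add (z : ℂ) (s t : ℝ≥0) :
    expKernel z (s + t) = expKernel z s * expKernel z t := by
  rw [expKernel, expKernel, expKernel, ← Complex.exp_add]
  congr 1
  push_cast
  ring

theorem ofFinite_congr {p q : Measure ℝ≥0} [IsFiniteMeasure p] [IsFiniteMeasure q] (h : p = q) :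
    ofFinite p = ofFinite q := by
  subst h
  rfl

/-- By dominated convergence the equality extends to the imaginary axis, where the transforms are
characteristic functions, and these determine a finite measure. -/
theorem measure_eq_of_laplace_eq {p q : Measure ℝ≥0} [IsFiniteMeasure p] [IsFiniteMeasure q]
    (h : ∀ z ∈ rightHalfPlane, ∫ t, expKernel z t ∂p = ∫ t, expKernel z t ∂q) : p = q := by
  have hlim : ∀ (r : Measure ℝ≥0) [IsFiniteMeasure r] (y : ℝ),
      Tendsto (fun n : ℕ => ∫ t, expKernel (((1 / ((n : ℝ) + 1) : ℝ) : ℂ) - y * Complex.I) t ∂r)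
        atTop (𝓝 (∫ t, expKernel (-(y * Complex.I)) t ∂r)) := fun r _ y => by
    refine tendsto_integral_filter_of_norm_le_const
      (Eventually.of_forall fun n => (continuous_expKernel _).aestronglyMeasurable)
      ⟨1, Eventually.of_forall fun n => Eventually.of_forall (norm_expKernel_le ?_)⟩
      (Eventually.of_forall fun t => ?_)
    · simp only [Complex.sub_re, Complex.ofReal_re, Complex.mul_re, Complex.I_re, mul_zero,
        Complex.ofReal_im, Complex.I_im, sub_zero, zero_mul]
      positivity
    · have h1 : Tendsto (fun n : ℕ => ((1 / ((n : ℝ) + 1) : ℝ) : ℂ) - y * Complex.I) atTop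
          (𝓝 (-(y * Complex.I))) := by
        have := ((Complex.continuous_ofReal.tendsto 0).comp
          (tendsto_one_div_add_atTop_nhds_zero_nat (𝕜 := ℝ))).sub_const ((y : ℂ) * Complex.I)
        simpa using this
      have h2 : Continuous fun w : ℂ => expKernel w t := by
        unfold expKernel
        fun_prop
      exact (h2.tendsto _).comp h1
  have heq : ∀ y : ℝ, ∫ t, expKernel (-(y * Complex.I)) t ∂p =
      ∫ t, expKernel (-(y * Complex.I)) t ∂q := fun y => by
    refine tendsto_nhds_unique ((hlim p y).congr fun n => h _ ?_) (hlim q y)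
    simp only [rightHalfPlane, Set.mem_ofPred_eq, Complex.sub_re, Complex.ofReal_re, Complex.mul_re,
      Complex.I_re, mul_zero, Complex.ofReal_im, Complex.I_im, sub_zero, zero_mul]
    positivity
  have hemb : MeasurableEmbedding ((↑) : ℝ≥0 → ℝ) :=
    MeasurableEmbedding.subtype_coe measurableSet_Ici
  have hchar : ∀ (r : Measure ℝ≥0) (y : ℝ), charFun (r.map ((↑) : ℝ≥0 → ℝ)) y =
      ∫ t, expKernel (-(y * Complex.I)) t ∂r := fun r y => by
    rw [charFun_apply_real, hemb.integral_map]
    refine integral_congr_ae (Eventually.of_forall fun t => ?_)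
    simp only [expKernel]
    congr 1
    ring
  have hmap : p.map ((↑) : ℝ≥0 → ℝ) = q.map ((↑) : ℝ≥0 → ℝ) := by
    refine Measure.ext_of_charFun (funext fun y => ?_)
    rw [hchar, hchar, heq]
  rw [← hemb.comap_map p, hmap, hemb.comap_map]

/-! ### Uniqueness and convolution of measures -/

section Transform

theorem BoundedC0Semigroup.exists_norm_orbit_le {X : Type*} [NormedAddCommGroup X]
    [NormedSpace ℂ X] (T : BoundedC0Semigroup X) (x : X) :
    ∃ C : ℝ, ∀ t, ‖T.op t x‖ ≤ C := by
  obtain ⟨M, hM⟩ := T.bounded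
  exact ⟨M * ‖x‖, fun t => (T.op t).le_of_opNorm_le (hM t) x⟩

theorem BoundedC0Semigroup.integrable_op {X : Type*} [NormedAddCommGroup X] [NormedSpace ℂ X]
    (T : BoundedC0Semigroup X) (p : Measure ℝ≥0) [IsFiniteMeasure p] (x : X) : Integrable (fun t => T.op t x) p := by
  obtain ⟨C, hC⟩ := T.exists_norm_orbit_le x
  exact Integrable.of_bound (T.continuous_op x).aestronglyMeasurable C (Eventually.of_forall hC)

variable {X : Type*} [NormedAddCommGroup X] [NormedSpace ℂ X] [CompleteSpace X]

/-- The Laplace transform of a complex measure, paired with its operator. -/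
def transform (T : BoundedC0Semigroup X) :
    ComplexMeasure ℝ≥0 →ₗ[ℂ] (rightHalfPlane → ℂ) × (X →L[ℂ] X) where
  toFun μ := (fun z => cintegral μ (expKernel z), measureOp T μ)
  map_add' μ ν := by
    refine Prod.ext (funext fun z => ?_) (ContinuousLinearMap.ext fun x => ?_)
    · exact cintegral_add_measure μ ν (continuous_expKernel _) (norm_expKernel_le (le_of_lt z.2))
    · obtain ⟨C, hC⟩ := T.exists_norm_orbit_le x
      exact cintegral_add_measure μ ν (T.continuous_op x) hC
  map_smul' c μ := by
    refine Prod.ext (funext fun z => ?_) (ContinuousLinearMap.ext fun x => ?_)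
    · exact cintegral_smul_measure c μ (continuous_expKernel _) (norm_expKernel_le (le_of_lt z.2))
    · obtain ⟨C, hC⟩ := T.exists_norm_orbit_le x
      exact cintegral_smul_measure c μ (T.continuous_op x) hC

theorem transform_ofFinite_fst (T : BoundedC0Semigroup X) (p : Measure ℝ≥0) [IsFiniteMeasure p]
    (z : rightHalfPlane) : (transform T (ofFinite p)).1 z = ∫ t, expKernel z t ∂p :=
  cintegral_ofFinite p (continuous_expKernel _) (norm_expKernel_le (le_of_lt z.2))

theorem transform_ofFinite_snd (T : BoundedC0Semigroup X) (p : Measure ℝ≥0) [IsFiniteMeasure p]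
    (x : X) : (transform T (ofFinite p)).2 x = ∫ t, T.op t x ∂p := by
  obtain ⟨C, hC⟩ := T.exists_norm_orbit_le x
  exact cintegral_ofFinite p (T.continuous_op x) hC

/-- A complex measure is determined by its Laplace transform. -/
theorem transform_fst_injective (T : BoundedC0Semigroup X) {μ ν : ComplexMeasure ℝ≥0}
    (h : (transform T μ).1 = (transform T ν).1) : μ = ν := by
  suffices hz : ∀ κ, (transform T κ).1 = 0 → κ = 0 by
    refine sub_eq_zero.1 (hz _ ?_)
    rw [map_sub, Prod.fst_sub, h, sub_self]
  intro κ hκ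
  have hdec := eq_combination_ofFinite κ
  set p₁ := (ComplexMeasure.re κ).toJordanDecomposition.posPart
  set p₂ := (ComplexMeasure.re κ).toJordanDecomposition.negPart
  set p₃ := (ComplexMeasure.im κ).toJordanDecomposition.posPart
  set p₄ := (ComplexMeasure.im κ).toJordanDecomposition.negPart
  have hval : ∀ z ∈ rightHalfPlane, (∫ t, expKernel z t ∂p₁ - ∫ t, expKernel z t ∂p₂) +
      Complex.I * (∫ t, expKernel z t ∂p₃ - ∫ t, expKernel z t ∂p₄) = 0 := fun z hz => by
    have := congrFun hκ ⟨z, hz⟩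
    rw [hdec, map_add, map_smul, map_sub, map_sub] at this
    simpa only [Prod.fst_add, Prod.smul_fst, Prod.fst_sub, Pi.add_apply, Pi.smul_apply,
      Pi.sub_apply, transform_ofFinite_fst, smul_eq_mul, Pi.zero_apply] using this
  -- Conjugating the relation at the conjugate point turns A + iB = 0 into A - iB = 0, so the real
  -- and imaginary parts of the measure separate.
  have hconj : ∀ (r : Measure ℝ≥0) (z : ℂ),
      ∫ t, expKernel ((starRingEnd ℂ) z) t ∂r = (starRingEnd ℂ) (∫ t, expKernel z t ∂r) :=
    fun r z => by
      rw [← integral_conj]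
      refine integral_congr_ae (Eventually.of_forall fun t => ?_)
      simp only [expKernel, ← Complex.exp_conj, map_neg, map_mul, Complex.conj_ofReal]
  have hval' : ∀ z ∈ rightHalfPlane, (∫ t, expKernel z t ∂p₁ - ∫ t, expKernel z t ∂p₂) -
      Complex.I * (∫ t, expKernel z t ∂p₃ - ∫ t, expKernel z t ∂p₄) = 0 := fun z hz => by
    have h1 := congrArg (starRingEnd ℂ) (hval ((starRingEnd ℂ) z)
      (by simpa [rightHalfPlane] using hz))
    rw [hconj, hconj, hconj, hconj] at h1
    simp only [map_add, map_sub, map_mul, Complex.conj_conj, Complex.conj_I, map_zero] at h1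
    rw [← h1]
    ring
  have h12 : p₁ = p₂ := measure_eq_of_laplace_eq fun z hz => by
    linear_combination (hval z hz + hval' z hz) / 2
  have h34 : p₃ = p₄ := measure_eq_of_laplace_eq fun z hz => by
    have h2 := hval z hz
    have h3 := hval' z hz
    have h4 : Complex.I * (∫ t, expKernel z t ∂p₃ - ∫ t, expKernel z t ∂p₄) = 0 := by
      linear_combination (h2 - h3) / 2
    exact sub_eq_zero.1 ((mul_eq_zero.1 h4).resolve_left Complex.I_ne_zero)
  rw [hdec, ofFinite_congr h12, ofFinite_congr h34, sub_self, sub_self, smul_zero, add_zero]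

/-- Convolution of finite measures. -/
theorem transform_ofFinite_mul (T : BoundedC0Semigroup X) (p q : Measure ℝ≥0) [IsFiniteMeasure p]
    [IsFiniteMeasure q] : transform T (ofFinite p) * transform T (ofFinite q) =
      transform T (ofFinite ((p.prod q).map fun a => a.1 + a.2)) := by
  have hm : Measurable fun a : ℝ≥0 × ℝ≥0 => a.1 + a.2 := by fun_prop
  refine Prod.ext (funext fun z => ?_) (ContinuousLinearMap.ext fun x => ?_)
  · have hz : 0 ≤ (z : ℂ).re := le_of_lt z.2
    rw [transform_ofFinite_fst, integral_map hm.aemeasurable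
      (continuous_expKernel _).aestronglyMeasurable]
    simp only [expKernel_add]
    rw [integral_prod_mul, Prod.fst_mul, Pi.mul_apply, transform_ofFinite_fst,
      transform_ofFinite_fst]
  · rw [transform_ofFinite_snd, integral_map hm.aemeasurable
      (T.continuous_op x).aestronglyMeasurable]
    obtain ⟨C, hC⟩ := T.exists_norm_orbit_le x
    have hint : Integrable (fun a : ℝ≥0 × ℝ≥0 => T.op (a.1 + a.2) x) (p.prod q) :=
      Integrable.of_bound ((T.continuous_op x).comp
        (continuous_fst.add continuous_snd)).aestronglyMeasurable C
        (Eventually.of_forall fun a => hC _)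
    rw [integral_prod _ hint]
    change (transform T (ofFinite p)).2 ((transform T (ofFinite q)).2 x) = _
    rw [transform_ofFinite_snd]
    refine integral_congr_ae (Eventually.of_forall fun s => ?_)
    simp only
    -- The bounded operator T(s) passes through the inner integral, and the semigroup law merges
    -- T(s)T(t).
    rw [transform_ofFinite_snd, ← ContinuousLinearMap.integral_comp_comm _ (T.integrable_op q x)]
    refine integral_congr_ae (Eventually.of_forall fun t => ?_)
    simp only [T.op_add]
    rfl

theorem transform_mem_span (T : BoundedC0Semigroup X) (μ : ComplexMeasure ℝ≥0) :
    transform T μ ∈ Submodule.span ℂ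
      {a | ∃ (p : Measure ℝ≥0) (_ : IsFiniteMeasure p), a = transform T (ofFinite p)} := by
  have hp : ∀ (p : Measure ℝ≥0) [IsFiniteMeasure p], transform T (ofFinite p) ∈ Submodule.span ℂ
      {a | ∃ (p : Measure ℝ≥0) (_ : IsFiniteMeasure p), a = transform T (ofFinite p)} :=
    fun p hp => Submodule.subset_span ⟨p, hp, rfl⟩
  rw [eq_combination_ofFinite μ, map_add, map_smul, map_sub, map_sub]
  exact add_mem (sub_mem (hp _) (hp _)) (Submodule.smul_mem _ _ (sub_mem (hp _) (hp _)))

open scoped Pointwise in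
/-- The range of `transform T` is closed under multiplication. -/
theorem exists_transform_eq_mul (T : BoundedC0Semigroup X) (μ ν : ComplexMeasure ℝ≥0) :
    ∃ κ, transform T κ = transform T μ * transform T ν := by
  have h1 := Submodule.mul_mem_mul (transform_mem_span T μ) (transform_mem_span T ν)
  -- A product of spans is the span of the products, so convolving finite measures suffices.
  rw [Submodule.span_mul_span] at h1
  have h2 : Submodule.span ℂ
      ({a | ∃ (p : Measure ℝ≥0) (_ : IsFiniteMeasure p), a = transform T (ofFinite p)} *
        {a | ∃ (p : Measure ℝ≥0) (_ : IsFiniteMeasure p), a = transform T (ofFinite p)}) ≤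
      LinearMap.range (transform T) := by
    refine Submodule.span_le.2 ?_
    rintro _ ⟨_, ⟨p, hp, rfl⟩, _, ⟨q, hq, rfl⟩, rfl⟩
    exact ⟨_, (transform_ofFinite_mul T p q).symm⟩
  exact h2 h1

end Transform

/-! ### The algebra of Laplace transforms and its functional calculus -/

section Calculus

/-- The first component of `transform T` does not depend on `T`, so `trivialSemigroup` may serve for
statements about functions alone. -/
theorem isLaplaceTransform_iff {X : Type*} [NormedAddCommGroup X] [NormedSpace ℂ X]
    [CompleteSpace X] (T : BoundedC0Semigroup X) {μ : ComplexMeasure ℝ≥0} {f : ℂ → ℂ} :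
    IsLaplaceTransform μ f ↔ (transform T μ).1 = fun z : rightHalfPlane => f z :=
  ⟨fun h => funext fun z => (h z z.2).symm, fun h z hz => (congrFun h ⟨z, hz⟩).symm⟩

/-- The semigroup of identities on `ℂ`. -/
def trivialSemigroup : BoundedC0Semigroup ℂ where
  op _ := 1
  op_zero := rfl
  op_add _ _ := (mul_one _).symm
  continuous_op _ := continuous_const
  bounded := ⟨‖(1 : ℂ →L[ℂ] ℂ)‖, fun _ => le_rfl⟩

theorem InLaplaceAlgebra.congr {f g : ℂ → ℂ} (hf : InLaplaceAlgebra f)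
    (h : EqOn f g rightHalfPlane) : InLaplaceAlgebra g := by
  obtain ⟨μ, hμ⟩ := hf
  exact ⟨μ, fun z hz => (h hz).symm.trans (hμ z hz)⟩

theorem InLaplaceAlgebra.add {f g : ℂ → ℂ} (hf : InLaplaceAlgebra f) (hg : InLaplaceAlgebra g) :
    InLaplaceAlgebra (f + g) := by
  obtain ⟨μ, hμ⟩ := hf
  obtain ⟨ν, hν⟩ := hg
  refine ⟨μ + ν, (isLaplaceTransform_iff trivialSemigroup).2 ?_⟩
  rw [map_add, Prod.fst_add, (isLaplaceTransform_iff trivialSemigroup).1 hμ,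
    (isLaplaceTransform_iff trivialSemigroup).1 hν]
  rfl

theorem InLaplaceAlgebra.smul {f : ℂ → ℂ} (c : ℂ) (hf : InLaplaceAlgebra f) :
    InLaplaceAlgebra (c • f) := by
  obtain ⟨μ, hμ⟩ := hf
  refine ⟨c • μ, (isLaplaceTransform_iff trivialSemigroup).2 ?_⟩
  rw [map_smul, Prod.smul_fst, (isLaplaceTransform_iff trivialSemigroup).1 hμ]
  rfl

theorem InLaplaceAlgebra.mul {f g : ℂ → ℂ} (hf : InLaplaceAlgebra f) (hg : InLaplaceAlgebra g) :
    InLaplaceAlgebra (f * g) := by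
  obtain ⟨μ, hμ⟩ := hf
  obtain ⟨ν, hν⟩ := hg
  obtain ⟨κ, hκ⟩ := exists_transform_eq_mul trivialSemigroup μ ν
  refine ⟨κ, (isLaplaceTransform_iff trivialSemigroup).2 ?_⟩
  rw [hκ, Prod.fst_mul, (isLaplaceTransform_iff trivialSemigroup).1 hμ,
    (isLaplaceTransform_iff trivialSemigroup).1 hν]
  rfl

theorem isLaplaceTransform_ofFinite (p : Measure ℝ≥0) [IsFiniteMeasure p] :
    IsLaplaceTransform (ofFinite p) fun z => ∫ t, expKernel z t ∂p :=
  (isLaplaceTransform_iff trivialSemigroup).2 (funext (transform_ofFinite_fst trivialSemigroup p))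

theorem inLaplaceAlgebra_ofFinite (p : Measure ℝ≥0) [IsFiniteMeasure p] :
    InLaplaceAlgebra fun z => ∫ t, expKernel z t ∂p :=
  ⟨_, isLaplaceTransform_ofFinite p⟩

theorem integral_expKernel_dirac (z : ℂ) : ∫ t, expKernel z t ∂(Measure.dirac (0 : ℝ≥0)) = 1 := by
  rw [integral_dirac]
  simp [expKernel]

theorem inLaplaceAlgebra_one : InLaplaceAlgebra 1 :=
  (inLaplaceAlgebra_ofFinite (Measure.dirac 0)).congr fun z _ => integral_expKernel_dirac z

theorem InLaplaceAlgebra.pow {f : ℂ → ℂ} (hf : InLaplaceAlgebra f) (n : ℕ) :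
    InLaplaceAlgebra (f ^ n) := by
  induction n with
  | zero => simpa using inLaplaceAlgebra_one
  | succ n ih => simpa [pow_succ] using ih.mul hf

theorem InLaplaceAlgebra.sum {ι : Type*} {f : ι → ℂ → ℂ} (s : Finset ι)
    (hf : ∀ i ∈ s, InLaplaceAlgebra (f i)) : InLaplaceAlgebra (∑ i ∈ s, f i) := by
  classical
  induction s using Finset.induction_on with
  | empty => simpa using inLaplaceAlgebra_one.smul 0
  | insert a s ha ih =>
    rw [Finset.sum_insert ha]
    exact (hf a (Finset.mem_insert_self a s)).add
      (ih fun i hi => hf i (Finset.mem_insert_of_mem hi))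

variable {X : Type*} [NormedAddCommGroup X] [NormedSpace ℂ X] [CompleteSpace X]
  (T : BoundedC0Semigroup X)

/-- Uniqueness of the representing measure makes the choice in the definition immaterial. -/
theorem hpBounded_eq {μ : ComplexMeasure ℝ≥0} {f : ℂ → ℂ} (h : IsLaplaceTransform μ f) :
    hpBounded T f = (transform T μ).2 := by
  have hf : InLaplaceAlgebra f := ⟨μ, h⟩
  have heq : hf.choose = μ := transform_fst_injective T
    (((isLaplaceTransform_iff T).1 hf.choose_spec).trans ((isLaplaceTransform_iff T).1 h).symm)
  rw [hpBounded, dif_pos hf, heq]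
  rfl

theorem hpBounded_congr {f g : ℂ → ℂ} (h : EqOn f g rightHalfPlane) :
    hpBounded T f = hpBounded T g := by
  by_cases hf : InLaplaceAlgebra f
  · obtain ⟨μ, hμ⟩ := hf
    rw [hpBounded_eq T hμ,
      hpBounded_eq T (μ := μ) (f := g) fun z hz => (h hz).symm.trans (hμ z hz)]
  -- Outside the algebra both sides take the default value 0.
  · rw [hpBounded, hpBounded, dif_neg hf, dif_neg fun hg => hf (hg.congr h.symm)]

theorem hpBounded_mul {f g : ℂ → ℂ} (hf : InLaplaceAlgebra f) (hg : InLaplaceAlgebra g) :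
    hpBounded T (f * g) = hpBounded T f * hpBounded T g := by
  obtain ⟨μ, hμ⟩ := hf
  obtain ⟨ν, hν⟩ := hg
  obtain ⟨κ, hκ⟩ := exists_transform_eq_mul T μ ν
  have h : IsLaplaceTransform κ (f * g) := by
    rw [isLaplaceTransform_iff T, hκ, Prod.fst_mul, (isLaplaceTransform_iff T).1 hμ,
      (isLaplaceTransform_iff T).1 hν]
    rfl
  rw [hpBounded_eq T h, hpBounded_eq T hμ, hpBounded_eq T hν, hκ, Prod.snd_mul]

theorem hpBounded_mul_apply {f g : ℂ → ℂ} (hf : InLaplaceAlgebra f) (hg : InLaplaceAlgebra g)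
    (x : X) : hpBounded T (f * g) x = hpBounded T f (hpBounded T g x) := by
  rw [hpBounded_mul T hf hg]
  rfl

theorem hpBounded_add {f g : ℂ → ℂ} (hf : InLaplaceAlgebra f) (hg : InLaplaceAlgebra g) :
    hpBounded T (f + g) = hpBounded T f + hpBounded T g := by
  obtain ⟨μ, hμ⟩ := hf
  obtain ⟨ν, hν⟩ := hg
  have h : IsLaplaceTransform (μ + ν) (f + g) := by
    rw [isLaplaceTransform_iff T, map_add, Prod.fst_add, (isLaplaceTransform_iff T).1 hμ,
      (isLaplaceTransform_iff T).1 hν]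
    rfl
  rw [hpBounded_eq T h, hpBounded_eq T hμ, hpBounded_eq T hν, map_add, Prod.snd_add]

theorem hpBounded_ofFinite (p : Measure ℝ≥0) [IsFiniteMeasure p] (x : X) :
    hpBounded T (fun z => ∫ t, expKernel z t ∂p) x = ∫ t, T.op t x ∂p := by
  rw [hpBounded_eq T (isLaplaceTransform_ofFinite p), transform_ofFinite_snd]

theorem hpBounded_one : hpBounded T 1 = 1 := by
  have h : EqOn (fun z => ∫ t, expKernel z t ∂(Measure.dirac (0 : ℝ≥0))) 1 rightHalfPlane :=
    fun z _ => integral_expKernel_dirac z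
  rw [← hpBounded_congr T h]
  ext x
  rw [hpBounded_ofFinite, integral_dirac, T.op_zero]

end Calculus

/-! ### The resolvent -/

section Resolvent

/-- The exponential distribution on `[0, ∞)`. -/
def expDistribution : Measure ℝ≥0 :=
  ((volume.restrict (Ioi (0 : ℝ))).withDensity
    fun t => ((Real.exp (-t)).toNNReal : ℝ≥0∞)).map Real.toNNReal

theorem integral_expDistribution {Y : Type*} [NormedAddCommGroup Y] [NormedSpace ℝ Y]
    {f : ℝ≥0 → Y} (hf : Continuous f) :
    ∫ t, f t ∂expDistribution = ∫ t in Ioi (0 : ℝ), Real.exp (-t) • f t.toNNReal := by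
  rw [expDistribution, integral_map (by fun_prop) hf.aestronglyMeasurable,
    integral_withDensity_eq_integral_smul (by fun_prop)]
  refine integral_congr_ae (Eventually.of_forall fun t => ?_)
  simp only [NNReal.smul_def, Real.coe_toNNReal _ (Real.exp_pos _).le]

instance isProbabilityMeasure_expDistribution : IsProbabilityMeasure expDistribution := by
  refine ⟨?_⟩
  rw [expDistribution, Measure.map_apply (by fun_prop) MeasurableSet.univ, preimage_univ,
    withDensity_apply _ MeasurableSet.univ, Measure.restrict_univ]
  change ∫⁻ t in Ioi (0 : ℝ), ENNReal.ofReal (Real.exp (-t)) = 1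
  rw [← ofReal_integral_eq_lintegral_ofReal (integrableOn_exp_neg_Ioi 0)
    (Eventually.of_forall fun t => (Real.exp_pos _).le), integral_exp_neg_Ioi_zero,
    ENNReal.ofReal_one]

theorem integral_expKernel_expDistribution {z : ℂ} (hz : 0 ≤ z.re) :
    ∫ t, expKernel z t ∂expDistribution = 1 / (1 + z) := by
  rw [integral_expDistribution (continuous_expKernel z)]
  have h1 : ∫ t in Ioi (0 : ℝ), Real.exp (-t) • expKernel z t.toNNReal =
      ∫ t : ℝ in Ioi 0, Complex.exp (-(1 + z) * t) := by
    refine setIntegral_congr_fun measurableSet_Ioi fun t ht => ?_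
    simp only [expKernel, Real.coe_toNNReal _ (le_of_lt (mem_Ioi.1 ht)), Complex.real_smul,
      Complex.ofReal_exp]
    rw [← Complex.exp_add]
    congr 1
    push_cast
    ring
  have hre : (-(1 + z)).re < 0 := by
    simp only [Complex.neg_re, Complex.add_re, Complex.one_re]
    linarith
  rw [h1, integral_exp_mul_complex_Ioi hre]
  simp only [Complex.ofReal_zero, mul_zero, Complex.exp_zero]
  rw [neg_div, div_neg, neg_neg]

theorem expKernel_mul (z : ℂ) (s t : ℝ≥0) : expKernel z (s * t) = expKernel ((s : ℝ) * z) t := by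
  rw [expKernel, expKernel]
  congr 1
  push_cast
  ring

/-- The representing measure is the exponential distribution scaled by s; for s = 0 it is the point
mass at 0. -/
theorem inLaplaceAlgebra_resolvent (s : ℝ≥0) :
    InLaplaceAlgebra fun z => 1 / (1 + (s : ℝ) * z) := by
  refine (inLaplaceAlgebra_ofFinite (expDistribution.map fun t => s * t)).congr fun z hz => ?_
  have hz' : 0 ≤ (((s : ℝ) : ℂ) * z).re := by
    rw [Complex.re_ofReal_mul]
    exact mul_nonneg s.2 (le_of_lt hz)
  simp only
  rw [integral_map (by fun_prop) (continuous_expKernel _).aestronglyMeasurable]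
  simp only [expKernel_mul]
  exact integral_expKernel_expDistribution hz'

variable {X : Type*} [NormedAddCommGroup X] [NormedSpace ℂ X] [CompleteSpace X]
  (T : BoundedC0Semigroup X)

theorem hpBounded_resolvent (s : ℝ≥0) (x : X) :
    hpBounded T (fun z => 1 / (1 + (s : ℝ) * z)) x = ∫ t, T.op (s * t) x ∂expDistribution := by
  have h : EqOn (fun z => ∫ t, expKernel z t ∂(expDistribution.map fun t => s * t))
      (fun z => 1 / (1 + (s : ℝ) * z)) rightHalfPlane := fun z hz => by
    have hz' : 0 ≤ (((s : ℝ) : ℂ) * z).re := by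
      rw [Complex.re_ofReal_mul]
      exact mul_nonneg s.2 (le_of_lt hz)
    simp only
    rw [integral_map (by fun_prop) (continuous_expKernel _).aestronglyMeasurable]
    simp only [expKernel_mul]
    exact integral_expKernel_expDistribution hz'
  rw [← hpBounded_congr T h, hpBounded_ofFinite,
    integral_map (by fun_prop) (T.continuous_op x).aestronglyMeasurable]

/-- Dominated convergence with T(st)x → x as s → 0+; the exponential distribution has total mass 1.
-/
theorem tendsto_hpBounded_resolvent (x : X) :
    Tendsto (fun n : ℕ => hpBounded T (fun z => 1 / (1 + ((1 / ((n : ℝ≥0) + 1) : ℝ≥0) : ℝ) * z)) x)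
      atTop (𝓝 x) := by
  simp only [hpBounded_resolvent]
  have h0 : x = ∫ _, x ∂expDistribution := by simp
  obtain ⟨C, hC⟩ := T.exists_norm_orbit_le x
  conv => arg 3; rw [h0]
  refine tendsto_integral_filter_of_norm_le_const (Eventually.of_forall fun n =>
    ((T.continuous_op x).comp (by fun_prop)).aestronglyMeasurable)
    ⟨C, Eventually.of_forall fun n => Eventually.of_forall fun t => hC _⟩
    (Eventually.of_forall fun t => ?_)
  have h1 : Tendsto (fun n : ℕ => 1 / ((n : ℝ≥0) + 1) * t) atTop (𝓝 0) := by
    simpa using (tendsto_one_div_add_atTop_nhds_zero_nat (𝕜 := ℝ≥0)).mul_const t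
  have h2 := ((T.continuous_op x).tendsto 0).comp h1
  rw [T.op_zero] at h2
  exact h2

theorem one_add_mul_ne_zero {z : ℂ} (hz : z ∈ rightHalfPlane) {s : ℝ} (hs : 0 ≤ s) :
    1 + (s : ℂ) * z ≠ 0 := fun h => by
  have h1 := congrArg Complex.re h
  rw [Complex.add_re, Complex.re_ofReal_mul] at h1
  have h2 : 0 < z.re := hz
  simp only [Complex.one_re, Complex.zero_re] at h1
  nlinarith [mul_nonneg hs h2.le]

theorem one_add_ne_zero {z : ℂ} (hz : z ∈ rightHalfPlane) : 1 + z ≠ 0 := by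
  simpa using one_add_mul_ne_zero hz zero_le_one

theorem inLaplaceAlgebra_psi_one : InLaplaceAlgebra (psi 1) :=
  (inLaplaceAlgebra_resolvent 1).congr fun z _ => by simp [psi]

theorem psi_eq_pow (k : ℕ) : psi k = psi 1 ^ k := by
  ext z
  simp [psi]

theorem psi_add (j k : ℕ) : psi (j + k) = psi j * psi k := by
  rw [psi_eq_pow, psi_eq_pow j, psi_eq_pow k, pow_add]

theorem inLaplaceAlgebra_psi (k : ℕ) : InLaplaceAlgebra (psi k) := by
  rw [psi_eq_pow]
  exact inLaplaceAlgebra_psi_one.pow k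

/-- The resolvent `(1 + A)⁻¹` is injective. -/
theorem injective_hpBounded_psi_one : Function.Injective (hpBounded T (psi 1)) := by
  rw [injective_iff_map_eq_zero]
  intro x hx
  refine tendsto_nhds_unique ((tendsto_hpBounded_resolvent T x).congr fun n => ?_)
    (tendsto_const_nhds (x := (0 : X)) (f := (atTop : Filter ℕ)))
  set s : ℝ≥0 := 1 / ((n : ℝ≥0) + 1) with hs
  have hs0 : s ≠ 0 := by rw [hs]; positivity
  have hsC : ((s : ℝ) : ℂ) ≠ 0 := by exact_mod_cast hs0
  have hin : InLaplaceAlgebra (((s : ℝ) : ℂ)⁻¹ • 1 +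
      (1 - ((s : ℝ) : ℂ)⁻¹) • fun z : ℂ => 1 / (1 + (s : ℝ) * z)) :=
    (inLaplaceAlgebra_one.smul _).add ((inLaplaceAlgebra_resolvent s).smul _)
  -- The resolvent identity: 1/(1+sz) is 1/(1+z) times an element of the algebra. Hence a vector
  -- killed by (1+A)⁻¹ is killed by every (1+sA)⁻¹, and these converge strongly to the identity.
  have heq : EqOn (fun z : ℂ => 1 / (1 + (s : ℝ) * z)) ((((s : ℝ) : ℂ)⁻¹ • 1 +
      (1 - ((s : ℝ) : ℂ)⁻¹) • fun z : ℂ => 1 / (1 + (s : ℝ) * z)) * psi 1) rightHalfPlane := by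
    intro z hz
    have h1 := one_add_mul_ne_zero hz s.2
    have h2 := one_add_ne_zero hz
    have h3 : (1 + ((s : ℝ) : ℂ) * z) ≠ 0 := h1
    simp only [Pi.mul_apply, Pi.add_apply, Pi.smul_apply, Pi.one_apply, smul_eq_mul, psi, pow_one]
    field_simp
    ring
  rw [hpBounded_congr T heq, hpBounded_mul_apply T hin inLaplaceAlgebra_psi_one, hx, map_zero]

theorem injective_hpBounded_psi (k : ℕ) : Function.Injective (hpBounded T (psi k)) := by
  induction k with
  | zero =>
    have : psi 0 = 1 := by
      ext z
      simp [psi]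
    rw [this, hpBounded_one]
    exact Function.injective_id
  | succ k ih =>
    rw [psi_add, hpBounded_mul T (inLaplaceAlgebra_psi k) inLaplaceAlgebra_psi_one]
    exact ih.comp (injective_hpBounded_psi_one T)

end Resolvent

/-! ### Holomorphic extensions -/

theorem isOpen_rightHalfPlane : IsOpen rightHalfPlane :=
  isOpen_lt continuous_const Complex.continuous_re

theorem isPreconnected_rightHalfPlane : IsPreconnected rightHalfPlane :=
  (convex_halfSpace_re_gt 0).isPreconnected

theorem ofReal_mem_rightHalfPlane {t : ℝ} (ht : 0 < t) : (t : ℂ) ∈ rightHalfPlane := by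
  simpa [rightHalfPlane] using ht

/-- Holomorphic functions on the right half-plane agreeing on a real half-line are equal. -/
theorem eqOn_rightHalfPlane {F G : ℂ → ℂ} (hF : DifferentiableOn ℂ F rightHalfPlane)
    (hG : DifferentiableOn ℂ G rightHalfPlane) {t₀ : ℝ} (ht₀ : 0 < t₀)
    (h : ∀ t : ℝ, t₀ < t → F t = G t) : EqOn F G rightHalfPlane := by
  refine (hF.analyticOnNhd isOpen_rightHalfPlane).eqOn_of_preconnected_of_frequently_eq
    (hG.analyticOnNhd isOpen_rightHalfPlane) isPreconnected_rightHalfPlane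
    (ofReal_mem_rightHalfPlane ht₀) ?_
  have htend : Tendsto (fun t : ℝ => (t : ℂ)) (𝓝[>] t₀) (𝓝[≠] (t₀ : ℂ)) := by
    refine tendsto_nhdsWithin_iff.2
      ⟨(Complex.continuous_ofReal.tendsto t₀).mono_left nhdsWithin_le_nhds, ?_⟩
    filter_upwards [self_mem_nhdsWithin] with t ht
    exact fun he => (ne_of_gt ht) (Complex.ofReal_injective he)
  refine htend.frequently (Eventually.frequently ?_)
  filter_upwards [self_mem_nhdsWithin] with t ht
  exact h t ht

/-- This is the complex moment generating function of -t, holomorphic over the interior of its real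
domain of integrability, which contains (0, ∞). -/
theorem differentiableOn_laplace (p : Measure ℝ≥0) [IsFiniteMeasure p] :
    DifferentiableOn ℂ (fun z => ∫ t, expKernel z t ∂p) rightHalfPlane := by
  have h1 := ProbabilityTheory.differentiableOn_complexMGF (X := fun t : ℝ≥0 => -(t : ℝ)) (μ := p)
  have h2 : Ioi (0 : ℝ) ⊆ interior (ProbabilityTheory.integrableExpSet
      (fun t : ℝ≥0 => -(t : ℝ)) p) := by
    refine interior_maximal (fun c hc => ?_) isOpen_Ioi
    refine Integrable.of_bound (Continuous.aestronglyMeasurable (by fun_prop)) 1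
      (Eventually.of_forall fun t => ?_)
    rw [mul_neg]
    exact norm_exp_neg_mul_le_one (le_of_lt hc) t
  refine (h1.mono fun z hz => h2 hz).congr fun z _ => ?_
  refine integral_congr_ae (Eventually.of_forall fun t => ?_)
  simp only [expKernel]
  congr 1
  push_cast
  ring

theorem laplace_ofReal (p : Measure ℝ≥0) (c : ℝ) :
    ∫ t, expKernel c t ∂p = ((∫ t, Real.exp (-(c * t)) ∂p : ℝ) : ℂ) := by
  rw [← integral_complex_ofReal]
  refine integral_congr_ae (Eventually.of_forall fun t => ?_)
  simp only [expKernel]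
  push_cast
  rfl

/-- A Bernstein function has a holomorphic extension `F`, and `F(z) / (1 + z)` is the Laplace
transform of a complex measure. -/
theorem IsBernstein.exists_isHolExt {f : ℝ → ℝ} (h : IsBernstein f) :
    ∃ F, IsHolExt f F ∧ InLaplaceAlgebra (psi 1 * F) := by
  obtain ⟨a, p, q, hp, hq, hf⟩ := h.exists_representation
  -- Since z/(1+z) = 1 - ψ_1, the quotient F/(1+z) equals aψ_1 + (1 - ψ_1)p̂ - ψ_1 q̂.
  have hin := ((inLaplaceAlgebra_psi_one.smul (a : ℂ)).add
    ((inLaplaceAlgebra_one.add (inLaplaceAlgebra_psi_one.smul (-1))).mul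
      (inLaplaceAlgebra_ofFinite p))).add
    ((inLaplaceAlgebra_psi_one.mul (inLaplaceAlgebra_ofFinite q)).smul (-1))
  refine ⟨fun z => a + z * ∫ t, expKernel z t ∂p - ∫ t, expKernel z t ∂q, ⟨?_, fun t ht => ?_⟩,
    hin.congr fun z hz => ?_⟩
  · exact ((differentiableOn_const _).add
      (differentiableOn_id.mul (differentiableOn_laplace p))).sub (differentiableOn_laplace q)
  · beta_reduce
    rw [laplace_ofReal, laplace_ofReal, hf t ht]
    push_cast
    rfl
  · have := one_add_ne_zero hz
    simp only [Pi.mul_apply, Pi.add_apply, Pi.smul_apply, Pi.one_apply, smul_eq_mul, psi, pow_one]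
    field_simp
    ring

theorem IsBernstein.isHolExt_holExt {f : ℝ → ℝ} (h : IsBernstein f) : IsHolExt f (holExt f) := by
  obtain ⟨F, hF, -⟩ := h.exists_isHolExt
  have hex : ∃ F, IsHolExt f F := ⟨F, hF⟩
  rw [holExt, dif_pos hex]
  exact hex.choose_spec

theorem IsBernstein.inLaplaceAlgebra_psi_mul_holExt {f : ℝ → ℝ} (h : IsBernstein f) :
    InLaplaceAlgebra (psi 1 * holExt f) := by
  obtain ⟨F, hF, hin⟩ := h.exists_isHolExt
  have heq : EqOn F (holExt f) rightHalfPlane :=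
    eqOn_rightHalfPlane hF.1 h.isHolExt_holExt.1 one_pos fun t ht => by
      have ht0 : 0 < t := one_pos.trans ht
      rw [hF.2 t ht0, h.isHolExt_holExt.2 t ht0]
  refine hin.congr fun z hz => ?_
  simp only [Pi.mul_apply, heq hz]

/-- For a special Bernstein function `f`, the extensions of `f` and of `t / f t` multiply to `z`. -/
theorem IsSpecialBernstein.holExt_mul {f : ℝ → ℝ} (h : IsSpecialBernstein f) :
    EqOn (holExt f * holExt fun t => t / f t) id rightHalfPlane := by
  obtain ⟨hf, ⟨t₀, ht₀, hne⟩, hg⟩ := h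
  refine eqOn_rightHalfPlane (hf.isHolExt_holExt.1.mul hg.isHolExt_holExt.1)
    differentiableOn_id ht₀ fun t ht => ?_
  have ht0 : 0 < t := ht₀.trans ht
  -- Positivity at one point t₀ propagates to the right by monotonicity; agreement on (t₀, ∞) is
  -- enough for the identity theorem.
  have hpos : 0 < f t := ((hf.2.1 t₀ ht₀).lt_of_ne hne.symm).trans_le
    (hf.monotoneOn ht₀ ht0 ht.le)
  rw [Pi.mul_apply, hf.isHolExt_holExt.2 t ht0, hg.isHolExt_holExt.2 t ht0, id,
    ← Complex.ofReal_mul, mul_div_cancel₀ _ hpos.ne']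

/-! ### The product formula -/

section Product

variable {X : Type*} [NormedAddCommGroup X] [NormedSpace ℂ X]

theorem mem_graph_invMul {R S : X →L[ℂ] X} (hR : Function.Injective R) {x y : X} :
    (x, y) ∈ (invMul R S).graph ↔ S x = R y := by
  rw [invMul, Submodule.toLinearPMap_graph_eq]
  · simp [LinearMap.mem_eqLocus]
  · rintro ⟨a, b⟩ hab ha
    simp only at ha
    subst ha
    have : R b = R 0 := by
      rw [LinearMap.mem_eqLocus] at hab
      simpa using hab.symm
    exact hR this

theorem mem_graph_opMul {R S : X →ₗ.[ℂ] X} {x y : X} :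
    (x, y) ∈ (opMul R S).graph ↔ ∃ w, (x, w) ∈ S.graph ∧ (w, y) ∈ R.graph := by
  simp only [LinearPMap.mem_graph_iff]
  constructor
  · rintro ⟨⟨_, hx, hx'⟩, rfl, rfl⟩
    exact ⟨_, ⟨⟨_, hx⟩, rfl, rfl⟩, ⟨_, hx'⟩, rfl, rfl⟩
  · rintro ⟨_, ⟨⟨x, hx⟩, rfl, rfl⟩, ⟨⟨w, hw⟩, hwS, rfl⟩⟩
    simp only at hwS
    subst hwS
    exact ⟨⟨x, hx, hw⟩, rfl, rfl⟩

variable [CompleteSpace X] (T : BoundedC0Semigroup X)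

theorem hpBounded_comm_apply {f g : ℂ → ℂ} (hf : InLaplaceAlgebra f) (hg : InLaplaceAlgebra g)
    (x : X) : hpBounded T f (hpBounded T g x) = hpBounded T g (hpBounded T f x) := by
  rw [← hpBounded_mul_apply T hf hg, mul_comm, hpBounded_mul_apply T hg hf]

/-- The extended calculus does not depend on the regulariser. -/
theorem mem_graph_hpCalculus {e f : ℂ → ℂ} (h : IsRegulariser T e f) {x y : X} :
    (x, y) ∈ (hpCalculus T f).graph ↔ hpBounded T (e * f) x = hpBounded T e y := by
  have hreg : IsRegularisable T f := ⟨e, h⟩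
  have key : ∀ {e₁ e₂ : ℂ → ℂ}, IsRegulariser T e₁ f → IsRegulariser T e₂ f →
      hpBounded T (e₁ * f) x = hpBounded T e₁ y → hpBounded T (e₂ * f) x = hpBounded T e₂ y :=
    fun {e₁ e₂} h₁ h₂ hxy => by
      -- Cancel the injective e₁(A) after commuting: e₁(e₂f) = e₂(e₁f).
      apply h₁.2.2.2
      rw [← hpBounded_mul_apply T h₁.2.1 h₂.2.2.1, mul_left_comm,
        hpBounded_mul_apply T h₂.2.1 h₁.2.2.1, hxy, hpBounded_comm_apply T h₁.2.1 h₂.2.1]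
  rw [hpCalculus, dif_pos hreg, mem_graph_invMul hreg.choose_spec.2.2.2]
  exact ⟨key hreg.choose_spec h, key h hreg.choose_spec⟩

theorem IsSpecialBernstein.isRegulariser {f : ℝ → ℝ} (hf : IsSpecialBernstein f) :
    IsRegulariser T (psi 1) (holExt f) :=
  ⟨hf.1.isHolExt_holExt.1, inLaplaceAlgebra_psi_one, hf.1.inLaplaceAlgebra_psi_mul_holExt,
    injective_hpBounded_psi_one T⟩

theorem psi_mul_psi_mul_mul (k : ℕ) (F g : ℂ → ℂ) :
    psi (k + 1) * (F * g) = psi 1 * F * (psi k * g) := by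
  rw [psi_add]
  ring

theorem IsSpecialBernstein.isRegulariser_mul {f : ℝ → ℝ} (hf : IsSpecialBernstein f) {g : ℂ → ℂ}
    {k : ℕ} (hg : IsRegulariser T (psi k) g) : IsRegulariser T (psi (k + 1)) (holExt f * g) := by
  refine ⟨hf.1.isHolExt_holExt.1.mul hg.1, inLaplaceAlgebra_psi _, ?_,
    injective_hpBounded_psi T _⟩
  rw [psi_mul_psi_mul_mul]
  exact hf.1.inLaplaceAlgebra_psi_mul_holExt.mul hg.2.2.1

/-- As zψ_1 = 1 - ψ_1, the geometric sum telescopes to 1 - ψ_1^k. -/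
theorem psi_add_id_mul_sum (k : ℕ) {z : ℂ} (hz : z ∈ rightHalfPlane) :
    psi k z + z * (psi 1 z * ∑ j ∈ Finset.range k, psi j z) = 1 := by
  have h0 : z * psi 1 z = 1 - psi 1 z := by
    have := one_add_ne_zero hz
    simp only [psi, pow_one]
    field_simp
    ring
  have h1 : ∀ j, psi j z = psi 1 z ^ j := fun j => by rw [psi_eq_pow, Pi.pow_apply]
  rw [← mul_assoc, h0, h1 k, Finset.sum_congr rfl fun j _ => h1 j, mul_neg_geom_sum]
  ring

/-- `f(A) g(A) = (f g)(A)` for a special Bernstein function `f`. -/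
theorem IsSpecialBernstein.opMul_hpCalculus {f : ℝ → ℝ} (hf : IsSpecialBernstein f) {g : ℂ → ℂ}
    {k : ℕ} (hg : IsRegulariser T (psi k) g) :
    opMul (hpCalculus T (holExt f)) (hpCalculus T g) = hpCalculus T (holExt f * g) := by
  refine LinearPMap.eq_of_eq_graph (SetLike.ext fun a => ?_)
  obtain ⟨x, y⟩ := a
  have hF := hf.1.inLaplaceAlgebra_psi_mul_holExt
  have hk := inLaplaceAlgebra_psi k
  have h1 := inLaplaceAlgebra_psi_one
  rw [mem_graph_opMul, mem_graph_hpCalculus T (hf.isRegulariser_mul T hg)]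
  simp only [mem_graph_hpCalculus T hg, mem_graph_hpCalculus T (hf.isRegulariser T)]
  rw [psi_mul_psi_mul_mul, hpBounded_mul_apply T hF hg.2.2.1, psi_add, hpBounded_mul_apply T hk h1]
  constructor
  · rintro ⟨w, hw, hw'⟩
    rw [hw, hpBounded_comm_apply T hF hk, hw']
  · intro hxy
    set H := holExt fun t => t / f t with hH
    have hHin : InLaplaceAlgebra (psi 1 * H * ∑ j ∈ Finset.range k, psi j) :=
      hf.2.2.inLaplaceAlgebra_psi_mul_holExt.mul
        (InLaplaceAlgebra.sum _ fun j _ => inLaplaceAlgebra_psi j)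
    set G := psi 1 * H * ∑ j ∈ Finset.range k, psi j with hG
    -- The vector (ψ_k g)(A)x + G(A)y is the candidate for g(A)x, read off from 1 = ψ_k + fG. The
    -- identity is checked after applying ψ_1(A), because ψ_1 f lies in the algebra while f itself
    -- need not.
    have hw : hpBounded T (psi k * g) x =
        hpBounded T (psi k) (hpBounded T (psi k * g) x + hpBounded T G y) := by
      apply injective_hpBounded_psi_one T
      rw [map_add, map_add, hpBounded_comm_apply T hk hHin, hpBounded_comm_apply T h1 hHin,
        hpBounded_comm_apply T h1 hk y, ← hxy, ← hpBounded_mul_apply T hF hg.2.2.1,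
        ← hpBounded_mul_apply T hHin (hF.mul hg.2.2.1), ← hpBounded_mul_apply T hk hg.2.2.1,
        ← hpBounded_mul_apply T h1 (hk.mul hg.2.2.1), ← hpBounded_mul_apply T h1 hg.2.2.1,
        ← add_apply, ← hpBounded_add T (h1.mul (hk.mul hg.2.2.1)) (hHin.mul (hF.mul hg.2.2.1))]
      congr 1
      refine hpBounded_congr T fun z hz => ?_
      have hFH : holExt f z * H z = z := hf.holExt_mul hz
      have hs := psi_add_id_mul_sum k hz
      simp only [hG, Pi.mul_apply, Pi.add_apply, Finset.sum_apply]
      linear_combination (-(psi 1 z * (psi k z * g z))) * hs -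
        (psi 1 z * psi 1 z * psi k z * g z * ∑ j ∈ Finset.range k, psi j z) * hFH
    -- It remains to see that f(A) maps this vector to y: apply ψ_k(A), commute, and use the
    -- hypothesis on x and y.
    refine ⟨_, hw, injective_hpBounded_psi T k ?_⟩
    rw [hpBounded_comm_apply T hk hF, ← hw, hxy]

/-- Each Bernstein factor costs one further power of 1/(1+z). -/
theorem isRegulariser_prod_holExt {n : ℕ} {f : Fin n → ℝ → ℝ} (hf : ∀ i, IsSpecialBernstein (f i))
    {g : ℂ → ℂ} {k : ℕ} (hg : IsRegulariser T (psi k) g) :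
    IsRegulariser T (psi (k + n)) ((∏ i, holExt (f i)) * g) := by
  induction n with
  | zero => simpa using hg
  | succ n ih =>
    rw [Fin.prod_univ_succ, mul_assoc]
    exact (hf 0).isRegulariser_mul T (ih fun i => hf i.succ)

/-- The one-factor formula applies to the outermost factor because the remaining product is again
regularised by some ψ_m, here with m the original exponent plus the number of remaining factors. -/
theorem foldr_opMul_hpCalculus {n : ℕ} {f : Fin n → ℝ → ℝ} (hf : ∀ i, IsSpecialBernstein (f i))
    {g : ℂ → ℂ} {k : ℕ} (hg : IsRegulariser T (psi k) g) :
    (List.ofFn fun i => hpCalculus T (holExt (f i))).foldr opMul (hpCalculus T g) =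
      hpCalculus T ((∏ i, holExt (f i)) * g) := by
  induction n with
  | zero => simp
  | succ n ih =>
    rw [List.ofFn_succ, List.foldr_cons, ih fun i => hf i.succ,
      (hf 0).opMul_hpCalculus T (isRegulariser_prod_holExt T (fun i => hf i.succ) hg),
      Fin.prod_univ_succ, mul_assoc]

end Product

end HillePhillips

end

theorem corollary5p6 {X : Type*} [NormedAddCommGroup X] [NormedSpace ℂ X] [CompleteSpace X]
    (A : X →ₗ.[ℂ] X) (T : HillePhillips.BoundedC0Semigroup X)
    (hA : HillePhillips.IsGenerator T (-A))
    (n : ℕ) (f : Fin n → ℝ → ℝ) (hf : ∀ i, HillePhillips.IsSpecialBernstein (f i))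
    (g : ℂ → ℂ) (k : ℕ) (hg : HillePhillips.IsRegulariser T (HillePhillips.psi k) g) :
    -- each `f i` has a holomorphic extension to the right half-plane, and `(f i)(A)` is defined
    (∀ i, HillePhillips.IsHolExt (f i) (HillePhillips.holExt (f i)) ∧
      HillePhillips.IsRegularisable T (HillePhillips.holExt (f i))) ∧
    -- `(f_1 ⋯ f_n g)(A)` is defined
    HillePhillips.IsRegularisable T ((∏ i, HillePhillips.holExt (f i)) * g) ∧
    -- `f_1(A) ⋯ f_n(A) g(A) = (f_1 ⋯ f_n g)(A)`, with equality of domains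
    (List.ofFn fun i => HillePhillips.hpCalculus T (HillePhillips.holExt (f i))).foldr
        HillePhillips.opMul (HillePhillips.hpCalculus T g) =
      HillePhillips.hpCalculus T ((∏ i, HillePhillips.holExt (f i)) * g) := by
  exact ⟨fun i => ⟨(hf i).1.isHolExt_holExt, _, (hf i).isRegulariser T⟩,
    ⟨_, HillePhillips.isRegulariser_prod_holExt T hf hg⟩,
    HillePhillips.foldr_opMul_hpCalculus T hf hg⟩
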